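/- Let $(M,g)$ be an oriented smooth 4-dimensional Lorentzian manifold of signature $(-+++)$ with Levi-Civita volume form $\varepsilon_{\alpha\beta\gamma\delta}$, and let $\nabla$ be a smooth affine connection on $M$ with $\nabla g=0$, coefficients $C^\gamma_{\alpha\beta}$ (so $\nabla_\alpha Y^\gamma=\partial_\alpha Y^\gamma+C^\gamma_{\alpha\beta}Y^\beta$) and torsion $S_{\alpha\beta}{}^\gamma=C^\gamma_{[\alpha\beta]}$. Let $R_{\alpha\beta\gamma}{}^\rho=\partial_\beta C^\rho_{\alpha\gamma}-\partial_\alpha C^\rho_{\beta\gamma}+C^\rho_{\beta\sigma}C^\sigma_{\alpha\gamma}-C^\rho_{\alpha\sigma}C^\sigma_{\beta\gamma}$, $R_{\alpha\beta}=R_{\alpha\mu\beta}{}^\mu$, $R=R_\mu{}^\mu$ be its Riemann tensor, Ricci tensor and Ricci scalar. Let $u$ be a smooth vector field on $M$ with $u_\alpha u^\alpha=-1$. Put $h_{\alpha\beta}=g_{\alpha\beta}+u_\alpha u_\beta$, $\varepsilon_{\alpha\beta\gamma}=\varepsilon_{\alpha\beta\gamma\sigma}u^\sigma$, $S_{\alpha\beta}=-h_\alpha{}^\mu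 h_\beta{}^\nu u^\sigma S_{\mu\nu\sigma}$, and define the torsion vector $S^\gamma=\tfrac12\varepsilon^{\gamma\mu\nu}S_{\mu\nu}$. With $B_\beta{}^\alpha=\nabla_\beta u^\alpha+2S_{\gamma\beta}{}^\alpha u^\gamma$ and $B_{\perp\alpha\beta}=h_\alpha{}^\gamma h_\beta{}^\sigma B_{\gamma\sigma}$, let $\theta=B_{\perp\gamma}{}^\gamma$, $\sigma_{\alpha\beta}=B_{\perp(\alpha\beta)}-\tfrac13h_{\alpha\beta}\theta$ and $\omega_{\alpha\beta}=B_{\perp[\alpha\beta]}$ be the expansion, shear and vorticity of $u$; for a function $f$ let $D_\alpha f=h_\alpha{}^\beta\partial_\beta f$. Suppose that the Einstein–Cartan field equations with cosmological constant $\Lambda$ hold for a Weyssenhoff fluid with 4-velocity $u$, that is, $$R_{\alpha\beta}-\tfrac12g_{\alpha\beta}R+\Lambda g_{\alpha\beta}=8\pi\left(\mu u_\alpha u_\beta+p\,h_{\alpha\beta}+q_\alpha u_\beta\right),\qquad S^{\alpha\beta\gamma}+2g^{\gamma[\alpha}S^{\beta]}{}_\mu{}^\mu=\Delta^{\alpha\beta}u^\gamma,$$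 for smooth functions $\mu,p$ on $M$, a vector field $q$ with $q_\alpha u^\alpha=0$ and an antisymmetric tensor field $\Delta^{\alpha\beta}$ with $\Delta^{\alpha\beta}u_\beta=0$. Suppose moreover that $\sigma_{\alpha\beta}=0$, $D_\alpha\theta=0$, $D_\alpha\mu=0$, $D_\alpha p=0$, $u^\beta\nabla_\beta u^\alpha=0$ and $\omega_{\alpha\beta}=S_{\alpha\beta}$ on $M$. Let $V$ be a simply connected hypersurface of $M$ without boundary that is everywhere orthogonal to $u$. If $S_\alpha S^\alpha\neq0$ at every point of $V$, then $V$ is not closed, i.e. not compact. -/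

import Mathlib

open scoped Manifold ContDiff Bundle

namespace EinsteinCartan

noncomputable section

universe v w

/-- The diagonal of the Minkowski metric, signature `(- + + +)`. -/
def eta (i : Fin 4) : ℝ := if i = 0 then -1 else 1

/-- A smooth Lorentzian metric, of signature `(- + + +)`, on a smooth 4-manifold. -/
structure LorentzMetric (M : Type v) [TopologicalSpace M]
    [ChartedSpace (EuclideanSpace ℝ (Fin 4)) M] [IsManifold (𝓡 4) ∞ M] where
  /-- the scalar product `g_x` on the tangent space at `x` -/
  val : ∀ x : M, TangentSpace (𝓡 4) x →L[ℝ] TangentSpace (𝓡 4) x →L[ℝ] ℝ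
  smooth : ContMDiff (𝓡 4)
    ((𝓡 4).prod 𝓘(ℝ, EuclideanSpace ℝ (Fin 4) →L[ℝ] EuclideanSpace ℝ (Fin 4) →L[ℝ] ℝ)) ∞
    (fun x ↦ Bundle.TotalSpace.mk'
      (EuclideanSpace ℝ (Fin 4) →L[ℝ] EuclideanSpace ℝ (Fin 4) →L[ℝ] ℝ)
      (E := fun x : M ↦ TangentSpace (𝓡 4) x →L[ℝ] TangentSpace (𝓡 4) x →L[ℝ] ℝ) x (val x))
  symm : ∀ (x : M) (a b : TangentSpace (𝓡 4) x), val x a b = val x b a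
  exists_orthonormal : ∀ x : M, ∃ e : Module.Basis (Fin 4) ℝ (TangentSpace (𝓡 4) x),
    ∀ i j, val x (e i) (e j) = if i = j then eta i else 0

/-- An oriented 4-dimensional Lorentzian manifold with a smooth metric compatible affine
connection; the torsion of the connection is arbitrary. -/
structure RiemannCartan (M : Type v) [TopologicalSpace M]
    [ChartedSpace (EuclideanSpace ℝ (Fin 4)) M] [IsManifold (𝓡 4) ∞ M] where
  /-- the metric -/
  g : LorentzMetric M
  /-- the Levi-Civita volume form `ε_{αβγδ}` of the metric and the orientation -/
  vol : ∀ x : M, TangentSpace (𝓡 4) x [⋀^Fin 4]→ₗ[ℝ] ℝ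
  /-- `ε` takes the values `± √|det g|`. -/
  vol_sq : ∀ (x : M) (a : Fin 4 → TangentSpace (𝓡 4) x),
    (vol x a) ^ 2 = -(Matrix.of fun i j ↦ g.val x (a i) (a j)).det
  /-- `ε` is a smooth 4-form: this makes the choice of sign an orientation of the manifold. -/
  vol_smooth : ∀ (X : Fin 4 → ∀ x : M, TangentSpace (𝓡 4) x) (x : M),
    (∀ i, ContMDiffAt (𝓡 4) (𝓡 4).tangent ∞ (fun y ↦ (X i y : TangentBundle (𝓡 4) M)) x) →
    ContMDiffAt (𝓡 4) 𝓘(ℝ) ∞ (fun y ↦ vol y fun i ↦ X i y) x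
  /-- the connection: `nabla Y x a` is `∇_a Y` at `x` -/
  nabla : CovariantDerivative (𝓡 4) (EuclideanSpace ℝ (Fin 4))
    (TangentSpace (𝓡 4) : M → Type _)
  nabla_smooth : nabla.ContMDiffCovariantDerivative ∞
  nabla_metric : ∀ (Y Z : ∀ x : M, TangentSpace (𝓡 4) x) (x : M),
    MDifferentiableAt (𝓡 4) (𝓡 4).tangent (fun y ↦ (Y y : TangentBundle (𝓡 4) M)) x →
    MDifferentiableAt (𝓡 4) (𝓡 4).tangent (fun y ↦ (Z y : TangentBundle (𝓡 4) M)) x →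
    ∀ a : TangentSpace (𝓡 4) x,
      mfderiv (𝓡 4) 𝓘(ℝ) (fun y ↦ g.val y (Y y) (Z y)) x a
        = g.val x (nabla Y x a) (Z x) + g.val x (Y x) (nabla Z x a)

section Geometry

variable {M : Type v} [TopologicalSpace M]
  [ChartedSpace (EuclideanSpace ℝ (Fin 4)) M] [IsManifold (𝓡 4) ∞ M]

namespace RiemannCartan

variable (G : RiemannCartan M)

/-- An orthonormal basis of the tangent space at `x`, used to write contractions. Every
contraction below is one of tensors, so it does not depend on the choice. -/
def frame (x : M) : Module.Basis (Fin 4) ℝ (TangentSpace (𝓡 4) x) :=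
  Classical.choose (G.g.exists_orthonormal x)

/-- The torsion tensor `S_{αβ}{}^γ = C_{[αβ]}{}^γ`, applied to two vectors: half of
`∇_X Y - ∇_Y X - [X, Y]`. -/
def torsionTensor (x : M) (a b : TangentSpace (𝓡 4) x) : TangentSpace (𝓡 4) x :=
  (1 / 2 : ℝ) • G.nabla.torsion x a b

/-- The trace `S_{αμ}{}^μ` of the torsion tensor. -/
def torsionTrace (x : M) (a : TangentSpace (𝓡 4) x) : ℝ :=
  ∑ i, eta i * G.g.val x (G.torsionTensor x a (G.frame x i)) (G.frame x i)

/-- The curvature operator of the connection on vector fields, with the sign convention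
`R(X, Y) Z = ∇_Y ∇_X Z - ∇_X ∇_Y Z + ∇_[X, Y] Z`. -/
def curvature (X Y Z : ∀ x : M, TangentSpace (𝓡 4) x) (x : M) : TangentSpace (𝓡 4) x :=
  G.nabla (fun y ↦ G.nabla Z y (X y)) x (Y x) - G.nabla (fun y ↦ G.nabla Z y (Y y)) x (X x)
    + G.nabla Z x (VectorField.mlieBracket (𝓡 4) X Y x)

/-- The Riemann tensor `R_{αβγ}{}^ρ` applied to three vectors at `x`, which are extended to a
neighbourhood of `x` as vector fields with constant coordinates in the preferred chart at `x`.
In that chart this is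
`∂_β C_{αγ}^ρ - ∂_α C_{βγ}^ρ + C_{βσ}^ρ C_{αγ}^σ - C_{ασ}^ρ C_{βγ}^σ`. -/
def riemann (x : M) (a b c : TangentSpace (𝓡 4) x) : TangentSpace (𝓡 4) x :=
  G.curvature (FiberBundle.extend (EuclideanSpace ℝ (Fin 4)) a)
    (FiberBundle.extend (EuclideanSpace ℝ (Fin 4)) b)
    (FiberBundle.extend (EuclideanSpace ℝ (Fin 4)) c) x

/-- The Ricci tensor `R_{αβ} = R_{αμβ}{}^μ`. -/
def ricci (x : M) (a b : TangentSpace (𝓡 4) x) : ℝ :=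
  ∑ i, eta i * G.g.val x (G.riemann x a (G.frame x i) b) (G.frame x i)

/-- The Ricci scalar `R = R_μ{}^μ`. -/
def scalar (x : M) : ℝ :=
  ∑ i, eta i * G.ricci x (G.frame x i) (G.frame x i)

section Congruence

variable (u : ∀ x : M, TangentSpace (𝓡 4) x)

/-- The projector `h_α{}^β = δ_α^β + u_α u^β` onto the orthogonal complement of `u`. -/
def proj (x : M) : TangentSpace (𝓡 4) x →L[ℝ] TangentSpace (𝓡 4) x :=
  ContinuousLinearMap.id ℝ (TangentSpace (𝓡 4) x) + (G.g.val x (u x)).smulRight (u x)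

/-- The tensor `h_{αβ} = g_{αβ} + u_α u_β`. -/
def h (x : M) (a b : TangentSpace (𝓡 4) x) : ℝ :=
  G.g.val x a b + G.g.val x (u x) a * G.g.val x (u x) b

/-- `B_β{}^α = ∇_β u^α + 2 S_{γβ}{}^α u^γ`, which governs the separation vector of the
congruence. -/
def sepTensor (x : M) : TangentSpace (𝓡 4) x →L[ℝ] TangentSpace (𝓡 4) x :=
  G.nabla u x + G.nabla.torsion x (u x)

/-- The orthogonal part `B_⊥{}_{αβ} = h_α{}^γ h_β{}^σ B_{γσ}`. -/
def sepPerp (x : M) (a b : TangentSpace (𝓡 4) x) : ℝ :=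
  G.g.val x (G.sepTensor u x (G.proj u x a)) (G.proj u x b)

/-- The expansion `θ = B_⊥{}_γ{}^γ`. -/
def expansion (x : M) : ℝ :=
  ∑ i, eta i * G.sepPerp u x (G.frame x i) (G.frame x i)

/-- The shear `σ_{αβ} = B_⊥{}_{(αβ)} - h_{αβ} θ / 3`. -/
def shear (x : M) (a b : TangentSpace (𝓡 4) x) : ℝ :=
  (G.sepPerp u x a b + G.sepPerp u x b a) / 2 - G.h u x a b * G.expansion u x / 3

/-- The vorticity `ω_{αβ} = B_⊥{}_{[αβ]}`. -/
def vorticity (x : M) (a b : TangentSpace (𝓡 4) x) : ℝ :=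
  (G.sepPerp u x a b - G.sepPerp u x b a) / 2

/-- The component `S_{αβ} = - h_α{}^μ h_β{}^ν u^σ S_{μνσ}` of the torsion. -/
def torsionTwo (x : M) (a b : TangentSpace (𝓡 4) x) : ℝ :=
  -G.g.val x (G.torsionTensor x (G.proj u x a) (G.proj u x b)) (u x)

/-- The projected Levi-Civita tensor `ε_{αβγ} = ε_{αβγσ} u^σ`. -/
def eps (x : M) (a b c : TangentSpace (𝓡 4) x) : ℝ := G.vol x ![a, b, c, u x]

/-- The torsion vector `S^γ = ½ ε^{γμν} S_{μν}`. -/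
def torsionVector (x : M) : TangentSpace (𝓡 4) x :=
  ∑ k, (eta k * ((1 / 2 : ℝ) * ∑ i, ∑ j, eta i * eta j *
    G.eps u x (G.frame x k) (G.frame x i) (G.frame x j) *
    G.torsionTwo u x (G.frame x i) (G.frame x j))) • G.frame x k

/-- The projected gradient `D_α f` of a function vanishes. -/
def NoSpatialGradient (f : M → ℝ) : Prop :=
  ∀ (x : M) (a : TangentSpace (𝓡 4) x), mfderiv (𝓡 4) 𝓘(ℝ) f x (G.proj u x a) = 0

end Congruence

end RiemannCartan

end Geometry

/-- A homogeneous cosmological model of the Einstein-Cartan theory whose source is a neutral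
Weyssenhoff fluid. -/
structure SpinningCosmology (M : Type v) [TopologicalSpace M]
    [ChartedSpace (EuclideanSpace ℝ (Fin 4)) M] [IsManifold (𝓡 4) ∞ M]
    extends RiemannCartan M where
  /-- the cosmological constant -/
  Λ : ℝ
  /-- the 4-velocity of the fluid -/
  u : ∀ x : M, TangentSpace (𝓡 4) x
  /-- the energy density -/
  μ : M → ℝ
  /-- the pressure -/
  p : M → ℝ
  /-- the heat flow -/
  q : ∀ x : M, TangentSpace (𝓡 4) x
  /-- the spin density tensor `Δ_{αβ}` -/
  spin : ∀ x : M, TangentSpace (𝓡 4) x →L[ℝ] TangentSpace (𝓡 4) x →L[ℝ] ℝ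
  u_smooth : ContMDiff (𝓡 4) (𝓡 4).tangent ∞ (fun x ↦ (u x : TangentBundle (𝓡 4) M))
  u_unit : ∀ x, g.val x (u x) (u x) = -1
  μ_smooth : ContMDiff (𝓡 4) 𝓘(ℝ) ∞ μ
  p_smooth : ContMDiff (𝓡 4) 𝓘(ℝ) ∞ p
  q_orthogonal : ∀ x, g.val x (q x) (u x) = 0
  spin_antisymm : ∀ x a b, spin x a b = -spin x b a
  spin_u : ∀ x a, spin x a (u x) = 0
  /-- `R_{αβ} - ½ g_{αβ} R + Λ g_{αβ} = 8π T_{αβ}` with the canonical stress-energy tensor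
  `T_{αβ} = μ u_α u_β + p h_{αβ} + q_α u_β` -/
  einstein : ∀ (x : M) (a b : TangentSpace (𝓡 4) x),
    toRiemannCartan.ricci x a b - (1 / 2) * g.val x a b * toRiemannCartan.scalar x
        + Λ * g.val x a b
      = 8 * Real.pi * (μ x * g.val x (u x) a * g.val x (u x) b
        + p x * toRiemannCartan.h u x a b + g.val x (q x) a * g.val x (u x) b)
  /-- `S_{αβγ} + 2 g_{γ[α} S_{β]μ}{}^μ = - 8π Δ_{αβγ}` with the intrinsic hypermomentum
  `Δ_{αβγ} = - Δ_{αβ} u_γ / (8π)` -/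
  cartan : ∀ (x : M) (a b c : TangentSpace (𝓡 4) x),
    g.val x (toRiemannCartan.torsionTensor x a b) c
        + (g.val x c a * toRiemannCartan.torsionTrace x b
          - g.val x c b * toRiemannCartan.torsionTrace x a)
      = -8 * Real.pi * (-(1 / (8 * Real.pi)) * spin x a b * g.val x (u x) c)
  shear_free : ∀ (x : M) (a b : TangentSpace (𝓡 4) x), toRiemannCartan.shear u x a b = 0
  expansion_homogeneous : toRiemannCartan.NoSpatialGradient u (toRiemannCartan.expansion u)
  μ_homogeneous : toRiemannCartan.NoSpatialGradient u μ
  p_homogeneous : toRiemannCartan.NoSpatialGradient u p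
  acceleration_free : ∀ x, nabla u x (u x) = 0
  vorticity_eq : ∀ (x : M) (a b : TangentSpace (𝓡 4) x),
    toRiemannCartan.vorticity u x a b = toRiemannCartan.torsionTwo u x a b

/-- `ι : V → M` exhibits the smooth 3-manifold without boundary `V` as a hypersurface of `M`
that is everywhere orthogonal to the congruence of `u`: a smooth injective map whose
differential at each point is an isomorphism onto the orthogonal complement of `u`. -/
structure IsOrthogonalSlice {M : Type v} [TopologicalSpace M]
    [ChartedSpace (EuclideanSpace ℝ (Fin 4)) M] [IsManifold (𝓡 4) ∞ M]
    (C : SpinningCosmology M)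
    {V : Type w} [TopologicalSpace V] [ChartedSpace (EuclideanSpace ℝ (Fin 3)) V]
    [IsManifold (𝓡 3) ∞ V] (ι : V → M) : Prop where
  smooth : ContMDiff (𝓡 3) (𝓡 4) ∞ ι
  injective : Function.Injective ι
  immersive : ∀ y : V, Function.Injective (mfderiv (𝓡 3) (𝓡 4) ι y)
  tangent : ∀ (y : V) (a : TangentSpace (𝓡 4) (ι y)),
    a ∈ Set.range (mfderiv (𝓡 3) (𝓡 4) ι y) ↔ C.g.val (ι y) a (C.u (ι y)) = 0

end

end EinsteinCartan

/-!
The Cartan equation forces the torsion to be `S_{αβ} u^γ`. For a geodesic shear-free congruence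
whose vorticity is `S_{αβ}` this gives `∇_α u_β = ⅓ θ h_{αβ} + S_{αβ}`. Contracting the Ricci
identity for `u` and using `D_α θ = 0` together with the Einstein equation `u^α R_{αβ} h^β{}_γ = 0`,
one finds that the spatial divergence of `S_{αβ}` vanishes. Since `S_α` is the spatial Hodge dual
of `S_{αβ}`, it restricts to a closed 1-form on a hypersurface orthogonal to `u`. If that
hypersurface is simply connected the restriction is `df` for some function `f`, and if it is also
compact `f` has a maximum, where `S_α` vanishes.
-/

namespace EinsteinCartan

noncomputable section

lemma eta_mul_self (i : Fin 4) : eta i * eta i = 1 := by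
  unfold eta; split_ifs <;> norm_num

section LorentzianAlgebra

variable {M : Type*} [TopologicalSpace M]
  [ChartedSpace (EuclideanSpace ℝ (Fin 4)) M] [IsManifold (𝓡 4) ∞ M]

namespace LorentzMetric

variable (g : LorentzMetric M) {x : M}

/-- A basis of a tangent space which is orthonormal for the Lorentzian metric; its vector of
index `0` is the timelike one. -/
def IsOrthonormal (e : Module.Basis (Fin 4) ℝ (TangentSpace (𝓡 4) x)) : Prop :=
  ∀ i j, g.val x (e i) (e j) = if i = j then eta i else 0

variable {g} {e f : Module.Basis (Fin 4) ℝ (TangentSpace (𝓡 4) x)}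

lemma IsOrthonormal.repr_eq (he : g.IsOrthonormal e) (a : TangentSpace (𝓡 4) x) (i : Fin 4) :
    e.repr a i = eta i * g.val x a (e i) := by
  have val_eq : g.val x a (e i) = e.repr a i * eta i := by
    conv_lhs => rw [← e.sum_repr a]
    simp only [map_sum, map_smul, sum_apply, smul_apply, he _ i, smul_eq_mul, mul_ite, mul_zero,
      Finset.sum_ite_eq', Finset.mem_univ, if_true]
  rw [val_eq, mul_left_comm, eta_mul_self, mul_one]

lemma IsOrthonormal.sum_eq (he : g.IsOrthonormal e) (a : TangentSpace (𝓡 4) x) :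
    ∑ i, (eta i * g.val x a (e i)) • e i = a := by
  simp_rw [← he.repr_eq]
  exact e.sum_repr a

lemma IsOrthonormal.sum_apply (he : g.IsOrthonormal e) (L : TangentSpace (𝓡 4) x →ₗ[ℝ] ℝ)
    (a : TangentSpace (𝓡 4) x) : ∑ i, eta i * g.val x a (e i) * L (e i) = L a := by
  conv_rhs => rw [← he.sum_eq a]
  simp

lemma IsOrthonormal.sum_val_mul_val (he : g.IsOrthonormal e) (a b : TangentSpace (𝓡 4) x) :
    ∑ i, eta i * g.val x a (e i) * g.val x b (e i) = g.val x a b := by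
  rw [g.symm x a b]
  exact he.sum_apply (g.val x b : TangentSpace (𝓡 4) x →ₗ[ℝ] ℝ) a

lemma eq_of_val_eq {a b : TangentSpace (𝓡 4) x} (h : ∀ c, g.val x a c = g.val x b c) : a = b := by
  obtain ⟨e, he : g.IsOrthonormal e⟩ := g.exists_orthonormal x
  rw [← he.sum_eq a, ← he.sum_eq b]
  simp_rw [h]

lemma IsOrthonormal.trace_eq (he : g.IsOrthonormal e) (hf : g.IsOrthonormal f)
    (B : TangentSpace (𝓡 4) x →ₗ[ℝ] TangentSpace (𝓡 4) x →ₗ[ℝ] ℝ) :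
    ∑ i, eta i * B (e i) (e i) = ∑ j, eta j * B (f j) (f j) := by
  calc ∑ i, eta i * B (e i) (e i)
      = ∑ i, ∑ j, eta i * (eta j * g.val x (e i) (f j) * B (e i) (f j)) :=
        Finset.sum_congr rfl fun i _ ↦ by rw [← Finset.mul_sum, hf.sum_apply]
    _ = ∑ j, ∑ i, eta j * (eta i * g.val x (f j) (e i) * B.flip (f j) (e i)) := by
        rw [Finset.sum_comm]
        refine Finset.sum_congr rfl fun j _ ↦ Finset.sum_congr rfl fun i _ ↦ ?_
        rw [g.symm x (f j), LinearMap.flip_apply]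
        ring
    _ = ∑ j, eta j * B (f j) (f j) :=
        Finset.sum_congr rfl fun j _ ↦ by rw [← Finset.mul_sum, he.sum_apply, LinearMap.flip_apply]

lemma IsOrthonormal.map (he : g.IsOrthonormal e)
    {L : TangentSpace (𝓡 4) x ≃ₗ[ℝ] TangentSpace (𝓡 4) x}
    (hL : ∀ a b, g.val x (L a) (L b) = g.val x a b) : g.IsOrthonormal (e.map L) := fun i j ↦ by
  simp only [Module.Basis.map_apply, hL, he i j]

lemma val_reflection {v : TangentSpace (𝓡 4) x} {φ : Module.Dual ℝ (TangentSpace (𝓡 4) x)}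
    (hφv : φ v = 2) (hφ : ∀ a, φ a * g.val x v v = 2 * g.val x v a)
    (a b : TangentSpace (𝓡 4) x) :
    g.val x (Module.reflection hφv a) (Module.reflection hφv b) = g.val x a b := by
  simp only [Module.reflection_apply, map_sub, map_smul, sub_apply, smul_apply, smul_eq_mul,
    g.symm x a v]
  linear_combination (φ a * hφ b + φ b * hφ a) / 2

-- The reflection in the hyperplane orthogonal to `e 0 - u` exchanges `e 0` and `u`.
lemma IsOrthonormal.exists_zero_eq (he : g.IsOrthonormal e) {u : TangentSpace (𝓡 4) x}
    (hu : g.val x u u = -1) (heu : g.val x (e 0) u ≠ -1) :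
    ∃ f : Module.Basis (Fin 4) ℝ (TangentSpace (𝓡 4) x), g.IsOrthonormal f ∧ f 0 = u := by
  set v := e 0 - u with hv
  have hve : g.val x v (e 0) = -1 - g.val x (e 0) u := by simp [hv, he 0 0, eta, g.symm x u]
  have hvv : g.val x v v = 2 * g.val x v (e 0) := by
    rw [hve]
    simp only [hv, map_sub, sub_apply, he 0 0, hu, g.symm x u (e 0)]
    simp only [eta, if_true]
    ring
  have hvv_ne : g.val x v v ≠ 0 := fun h0 ↦ heu (by linarith)
  let φ : Module.Dual ℝ (TangentSpace (𝓡 4) x) :=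
    (2 / g.val x v v) • (g.val x v : TangentSpace (𝓡 4) x →ₗ[ℝ] ℝ)
  have hφ (a) : φ a * g.val x v v = 2 * g.val x v a := by
    change 2 / g.val x v v * g.val x v a * g.val x v v = _
    field_simp
  have hφv : φ v = 2 := mul_right_cancel₀ hvv_ne (hφ v)
  have hφe : φ (e 0) = 1 := mul_right_cancel₀ hvv_ne (by rw [hφ, one_mul, hvv])
  refine ⟨e.map (Module.reflection hφv), he.map (val_reflection hφv hφ), ?_⟩
  rw [Module.Basis.map_apply, Module.reflection_apply, hφe, one_smul, hv, sub_sub_cancel]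

lemma exists_isOrthonormal_zero_eq {u : TangentSpace (𝓡 4) x} (hu : g.val x u u = -1) :
    ∃ f : Module.Basis (Fin 4) ℝ (TangentSpace (𝓡 4) x), g.IsOrthonormal f ∧ f 0 = u := by
  obtain ⟨e, he : g.IsOrthonormal e⟩ := g.exists_orthonormal x
  by_cases heu : g.val x (e 0) u = -1
  · have he_neg := he.map (L := LinearEquiv.neg ℝ) fun a b ↦ by simp
    refine he_neg.exists_zero_eq hu ?_
    norm_num [heu]
  · exact he.exists_zero_eq hu heu

lemma IsOrthonormal.det_toMatrix_mul (he : g.IsOrthonormal e)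
    (a b : Fin 4 → TangentSpace (𝓡 4) x) :
    e.det a * e.det b = -(Matrix.of fun i j ↦ g.val x (a i) (b j)).det := by
  have gram : (Matrix.of fun i j ↦ g.val x (a i) (b j))
      = (e.toMatrix a).transpose * Matrix.diagonal eta * e.toMatrix b := by
    ext i j
    rw [Matrix.of_apply, ← he.sum_val_mul_val, Matrix.mul_apply]
    refine Finset.sum_congr rfl fun k _ ↦ ?_
    rw [Matrix.mul_diagonal, Matrix.transpose_apply, Module.Basis.toMatrix_apply,
      Module.Basis.toMatrix_apply, he.repr_eq, he.repr_eq]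
    linear_combination (-eta k * g.val x (a i) (e k) * g.val x (b j) (e k)) * eta_mul_self k
  rw [gram, Matrix.det_mul, Matrix.det_mul, Matrix.det_transpose, Matrix.det_diagonal,
    Fin.prod_univ_four, Module.Basis.det_apply, Module.Basis.det_apply]
  simp [eta]

end LorentzMetric

namespace RiemannCartan

variable (G : RiemannCartan M)

lemma frame_isOrthonormal (x : M) : G.g.IsOrthonormal (G.frame x) :=
  Classical.choose_spec (G.g.exists_orthonormal x)

lemma vol_mul_vol (x : M) (a b : Fin 4 → TangentSpace (𝓡 4) x) :
    G.vol x a * G.vol x b = -(Matrix.of fun i j ↦ G.g.val x (a i) (b j)).det := by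
  have he := G.frame_isOrthonormal x
  set e := G.frame x
  have vol_frame : G.vol x e * G.vol x e = 1 := by
    rw [← sq, G.vol_sq, ← he.det_toMatrix_mul, e.det_self, one_mul]
  rw [← he.det_toMatrix_mul, (G.vol x).eq_smul_basis_det e, AlternatingMap.smul_apply,
    AlternatingMap.smul_apply, smul_eq_mul, smul_eq_mul]
  linear_combination (e.det a * e.det b) * vol_frame

variable (u : ∀ x : M, TangentSpace (𝓡 4) x) (x : M)

lemma proj_apply (a : TangentSpace (𝓡 4) x) :
    G.proj u x a = a + G.g.val x (u x) a • u x := by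
  simp [proj]

lemma h_eq_val_proj (a b : TangentSpace (𝓡 4) x) : G.h u x a b = G.g.val x (G.proj u x a) b := by
  simp [h, proj_apply]

lemma h_comm (a b : TangentSpace (𝓡 4) x) : G.h u x a b = G.h u x b a := by
  rw [h, h, G.g.symm, mul_comm (G.g.val x (u x) a)]

lemma torsionTwo_swap (a b : TangentSpace (𝓡 4) x) :
    G.torsionTwo u x a b = -G.torsionTwo u x b a := by
  simp only [torsionTwo, torsionTensor]
  rw [G.nabla.torsion_antisymm]
  simp

lemma torsionTwo_self (a : TangentSpace (𝓡 4) x) : G.torsionTwo u x a a = 0 :=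
  self_eq_neg.mp (G.torsionTwo_swap u x a a)

end RiemannCartan

end LorentzianAlgebra

section HodgeDual

variable {M : Type*} [TopologicalSpace M]
  [ChartedSpace (EuclideanSpace ℝ (Fin 4)) M] [IsManifold (𝓡 4) ∞ M]

namespace RiemannCartan

variable (G : RiemannCartan M) (u : ∀ x : M, TangentSpace (𝓡 4) x) (x : M)

lemma eps_self_left (b c : TangentSpace (𝓡 4) x) : G.eps u x (u x) b c = 0 :=
  (G.vol x).map_eq_zero_of_eq ![u x, b, c, u x] (i := 0) (j := 3) rfl (by decide)

lemma sum_eps_mul {ι : Type*} (s : Finset ι) (r : ι → ℝ) (a : ι → TangentSpace (𝓡 4) x)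
    (b c : TangentSpace (𝓡 4) x) :
    ∑ i ∈ s, r i * G.eps u x (a i) b c = G.eps u x (∑ i ∈ s, r i • a i) b c := by
  let L : TangentSpace (𝓡 4) x →ₗ[ℝ] ℝ :=
    { toFun := fun a ↦ G.eps u x a b c
      map_add' := (G.vol x).map_vecCons_add ![b, c, u x]
      map_smul' := (G.vol x).map_vecCons_smul ![b, c, u x] }
  change ∑ i ∈ s, r i * L (a i) = L (∑ i ∈ s, r i • a i)
  simp

variable {x} in
lemma eps_mul_eps (hu : G.g.val x (u x) (u x) = -1) (a b c a' b' c' : TangentSpace (𝓡 4) x) :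
    G.eps u x a b c * G.eps u x a' b' c'
      = G.h u x a a' * (G.h u x b b' * G.h u x c c' - G.h u x b c' * G.h u x c b')
        + G.h u x b a' * (G.h u x c b' * G.h u x a c' - G.h u x c c' * G.h u x a b')
        + G.h u x c a' * (G.h u x a b' * G.h u x b c' - G.h u x a c' * G.h u x b b') := by
  rw [eps, eps, G.vol_mul_vol]
  simp only [h, Matrix.det_succ_row_zero, Fin.sum_univ_succ, Matrix.of_apply, Matrix.submatrix,
    Matrix.det_unique, Fin.succAbove, Fin.default_eq_zero]
  simp [Fin.lt_def, Fin.succ, hu, G.g.symm x _ (u x)]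
  ring

lemma val_torsionVector (c : TangentSpace (𝓡 4) x) :
    G.g.val x (G.torsionVector u x) c = 1 / 2 * ∑ i, ∑ j, eta i * eta j *
      G.eps u x c (G.frame x i) (G.frame x j) * G.torsionTwo u x (G.frame x i) (G.frame x j) := by
  have he := G.frame_isOrthonormal x
  have eps_eq (i j : Fin 4) : G.eps u x c (G.frame x i) (G.frame x j)
      = ∑ k, eta k * G.g.val x c (G.frame x k)
        * G.eps u x (G.frame x k) (G.frame x i) (G.frame x j) := by
    rw [sum_eps_mul, he.sum_eq]
  simp only [torsionVector, map_sum, map_smul, sum_apply, smul_apply, smul_eq_mul, eps_eq,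
    Finset.mul_sum, Finset.sum_mul]
  rw [Finset.sum_comm]
  refine Finset.sum_congr rfl fun i _ ↦ ?_
  rw [Finset.sum_comm]
  refine Finset.sum_congr rfl fun j _ ↦ Finset.sum_congr rfl fun k _ ↦ ?_
  rw [G.g.symm x c]
  ring

lemma val_torsionVector_self : G.g.val x (G.torsionVector u x) (u x) = 0 := by
  simp [val_torsionVector, eps_self_left]

variable {x} in
lemma proj_proj (hu : G.g.val x (u x) (u x) = -1) (a : TangentSpace (𝓡 4) x) :
    G.proj u x (G.proj u x a) = G.proj u x a := by
  simp [proj_apply, hu]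

variable {x} in
lemma sum_h_mul_h_mul_torsionTwo (hu : G.g.val x (u x) (u x) = -1)
    (p q : TangentSpace (𝓡 4) x) :
    ∑ i, ∑ j, eta i * eta j * (G.h u x p (G.frame x i) * G.h u x q (G.frame x j)) *
      G.torsionTwo u x (G.frame x i) (G.frame x j) = G.torsionTwo u x p q := by
  have he := G.frame_isOrthonormal x
  have torsionTwo_proj : G.torsionTwo u x (G.proj u x p) (G.proj u x q) = G.torsionTwo u x p q := by
    simp only [torsionTwo, G.proj_proj u hu]
  rw [← torsionTwo_proj]
  conv_rhs => rw [← he.sum_eq (G.proj u x p), ← he.sum_eq (G.proj u x q)]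
  simp only [torsionTwo, torsionTensor, h_eq_val_proj, map_sum, map_smul, sum_apply, smul_apply,
    smul_eq_mul, ← Finset.sum_neg_distrib, Finset.smul_sum]
  rw [Finset.sum_comm]
  refine Finset.sum_congr rfl fun i _ ↦ Finset.sum_congr rfl fun j _ ↦ ?_
  ring

-- The torsion vector is the spatial Hodge dual of `S_{αβ}`.
variable {x} in
lemma eps_mul_val_torsionVector (hu : G.g.val x (u x) (u x) = -1)
    (a b d c : TangentSpace (𝓡 4) x) :
    G.eps u x a b d * G.g.val x (G.torsionVector u x) c
      = G.torsionTwo u x b d * G.h u x a c + G.torsionTwo u x d a * G.h u x b c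
        + G.torsionTwo u x a b * G.h u x d c := by
  have contract := G.sum_h_mul_h_mul_torsionTwo u hu
  calc G.eps u x a b d * G.g.val x (G.torsionVector u x) c
      = 1 / 2 * (G.h u x a c * (G.torsionTwo u x b d - G.torsionTwo u x d b)
        + G.h u x b c * (G.torsionTwo u x d a - G.torsionTwo u x a d)
        + G.h u x d c * (G.torsionTwo u x a b - G.torsionTwo u x b a)) := by
        simp only [val_torsionVector, ← contract b d, ← contract d b, ← contract d a,
          ← contract a d, ← contract a b, ← contract b a, ← Finset.sum_sub_distrib,
          Finset.mul_sum, ← Finset.sum_add_distrib]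
        refine Finset.sum_congr rfl fun i _ ↦ Finset.sum_congr rfl fun j _ ↦ ?_
        linear_combination (1 / 2 * eta i * eta j
          * G.torsionTwo u x (G.frame x i) (G.frame x j))
          * G.eps_mul_eps u hu a b d c (G.frame x i) (G.frame x j)
    _ = _ := by
        rw [G.torsionTwo_swap u x d b, G.torsionTwo_swap u x a d, G.torsionTwo_swap u x b a]
        ring

end RiemannCartan

end HodgeDual

section CoordinateFields

variable {n : ℕ} {M : Type*} [TopologicalSpace M]
  [ChartedSpace (EuclideanSpace ℝ (Fin n)) M] [IsManifold (𝓡 n) ∞ M] {x y : M}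

/-- The vector field with constant components `a` in the preferred chart at `x`. -/
abbrev coordField {x : M} (a : TangentSpace (𝓡 n) x) (y : M) : TangentSpace (𝓡 n) y :=
  FiberBundle.extend (EuclideanSpace ℝ (Fin n)) a y

lemma coordField_self (a : TangentSpace (𝓡 n) x) : coordField a x = a :=
  FiberBundle.extend_apply_self _ a

lemma coordField_eq_symmL (a : TangentSpace (𝓡 n) x)
    (hy : y ∈ (chartAt (EuclideanSpace ℝ (Fin n)) x).source) :
    coordField a y
      = (trivializationAt (EuclideanSpace ℝ (Fin n)) (TangentSpace (𝓡 n)) x).symmL ℝ y a := by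
  have triv_self :
      (trivializationAt (EuclideanSpace ℝ (Fin n)) (TangentSpace (𝓡 n)) x ⟨x, a⟩).2 = a := by
    have triv_id := TangentBundle.continuousLinearMapAt_trivializationAt (I := 𝓡 n) (x₀ := x)
      (x := x) (mem_chart_source _ x)
    rw [mfderiv_extChartAt_self] at triv_id
    have triv_apply := congrArg (fun L ↦ L a) triv_id
    rw [Bundle.Trivialization.continuousLinearMapAt_apply,
      Bundle.Trivialization.linearMapAt_apply, if_pos (by simp)] at triv_apply
    exact triv_apply
  rw [coordField, FiberBundle.extend, triv_self]
  exact (Bundle.Trivialization.symmL_apply (R := ℝ)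
    (trivializationAt (EuclideanSpace ℝ (Fin n)) (TangentSpace (𝓡 n)) x) (by simpa using hy)
    (show EuclideanSpace ℝ (Fin n) from a)).symm

lemma coordField_eq_mfderiv (a : TangentSpace (𝓡 n) x)
    (hy : y ∈ (chartAt (EuclideanSpace ℝ (Fin n)) x).source) :
    coordField a y = mfderiv 𝓘(ℝ, EuclideanSpace ℝ (Fin n)) (𝓡 n) (extChartAt (𝓡 n) x).symm
      (extChartAt (𝓡 n) x y) a := by
  rw [coordField_eq_symmL a hy, TangentBundle.symmL_trivializationAt hy]
  simp only [ModelWithCorners.range_eq_univ, mfderivWithin_univ]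
  rfl

lemma coordField_add (a b : TangentSpace (𝓡 n) x)
    (hy : y ∈ (chartAt (EuclideanSpace ℝ (Fin n)) x).source) :
    coordField (a + b) y = coordField a y + coordField b y := by
  rw [coordField_eq_symmL _ hy, coordField_eq_symmL _ hy, coordField_eq_symmL _ hy]
  exact map_add _ _ _

lemma coordField_smul (c : ℝ) (a : TangentSpace (𝓡 n) x)
    (hy : y ∈ (chartAt (EuclideanSpace ℝ (Fin n)) x).source) :
    coordField (c • a) y = c • coordField a y := by
  rw [coordField_eq_symmL _ hy, coordField_eq_symmL _ hy]
  exact map_smul _ _ _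

lemma contMDiffAt_coordField (a : TangentSpace (𝓡 n) x)
    (hy : y ∈ (chartAt (EuclideanSpace ℝ (Fin n)) x).source) :
    ContMDiffAt (𝓡 n) (𝓡 n).tangent ∞ (fun z ↦ (coordField a z : TangentBundle (𝓡 n) M)) y := by
  set t := trivializationAt (EuclideanSpace ℝ (Fin n)) (TangentSpace (𝓡 n)) x
  have hyt : y ∈ t.baseSet := by simpa [t] using hy
  refine (t.contMDiffAt_section_iff (IB := 𝓡 n) hyt).2 ?_
  refine (contMDiffAt_const (c := (t ⟨x, a⟩).2)).congr_of_eventuallyEq ?_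
  filter_upwards [t.open_baseSet.mem_nhds hyt] with z hz
  change (t ⟨z, t.symm z (t ⟨x, a⟩).2⟩).2 = _
  rw [t.apply_mk_symm hz]

lemma mdifferentiableAt_extChartAt_symm' {z : EuclideanSpace ℝ (Fin n)}
    (hz : z ∈ (extChartAt (𝓡 n) x).target) :
    MDifferentiableAt 𝓘(ℝ, EuclideanSpace ℝ (Fin n)) (𝓡 n) (extChartAt (𝓡 n) x).symm z := by
  have := mdifferentiableWithinAt_extChartAt_symm (I := 𝓡 n) hz
  simpa [mdifferentiableWithinAt_univ] using this

lemma mfderiv_coordField {f : M → ℝ} (a : TangentSpace (𝓡 n) x)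
    (hy : y ∈ (chartAt (EuclideanSpace ℝ (Fin n)) x).source)
    (hf : MDifferentiableAt (𝓡 n) 𝓘(ℝ) f y) :
    mfderiv (𝓡 n) 𝓘(ℝ) f y (coordField a y)
      = fderiv ℝ (f ∘ (extChartAt (𝓡 n) x).symm) (extChartAt (𝓡 n) x y) a := by
  have hy' : y ∈ (extChartAt (𝓡 n) x).source := by simpa using hy
  have hφy : (extChartAt (𝓡 n) x).symm (extChartAt (𝓡 n) x y) = y :=
    (extChartAt (𝓡 n) x).left_inv hy'
  rw [coordField_eq_mfderiv a hy, ← mfderiv_eq_fderiv, mfderiv_comp_of_eq (y := y) hf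
    (mdifferentiableAt_extChartAt_symm' ((extChartAt (𝓡 n) x).map_source hy')) hφy]
  change _ = mfderiv (𝓡 n) 𝓘(ℝ) f ((extChartAt (𝓡 n) x).symm (extChartAt (𝓡 n) x y))
    (mfderiv 𝓘(ℝ, EuclideanSpace ℝ (Fin n)) (𝓡 n) (extChartAt (𝓡 n) x).symm
      (extChartAt (𝓡 n) x y) a)
  rw [hφy]

/-- The constant vector field `a` on a normed space, as a section of the tangent bundle. -/
def constField {E : Type*} [NormedAddCommGroup E] [NormedSpace ℝ E] (a : E) :
    ∀ z : E, TangentSpace 𝓘(ℝ, E) z := fun _ ↦ a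

lemma coordField_eventuallyEq_mpullback (a : TangentSpace (𝓡 n) x)
    (hy : y ∈ (chartAt (EuclideanSpace ℝ (Fin n)) x).source) :
    coordField a =ᶠ[nhds y] VectorField.mpullback (𝓡 n) 𝓘(ℝ, EuclideanSpace ℝ (Fin n))
      (extChartAt (𝓡 n) x) (constField (show EuclideanSpace ℝ (Fin n) from a)) := by
  filter_upwards [(chartAt (EuclideanSpace ℝ (Fin n)) x).open_source.mem_nhds hy] with z hz
  rw [VectorField.mpullback_apply]
  refine ((isInvertible_mfderiv_extChartAt (by simpa using hz)).inverse_apply_eq.2 ?_).symm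
  rw [coordField_eq_symmL a hz, ← TangentBundle.continuousLinearMapAt_trivializationAt hz]
  exact (Bundle.Trivialization.continuousLinearMapAt_symmL (R := ℝ)
    (trivializationAt (EuclideanSpace ℝ (Fin n)) (TangentSpace (𝓡 n)) x) (by simpa using hz)
    (show EuclideanSpace ℝ (Fin n) from a)).symm

lemma mlieBracket_constField {E : Type*} [NormedAddCommGroup E] [NormedSpace ℝ E] (a b : E) :
    VectorField.mlieBracket 𝓘(ℝ, E) (constField a) (constField b) = 0 := by
  ext1 z
  have lieBracket_eq_zero :
      VectorField.lieBracketWithin ℝ (fun _ : E ↦ a) (fun _ ↦ b) Set.univ z = 0 := by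
    simp [VectorField.lieBracketWithin_univ, VectorField.lieBracket_eq]
  rw [← VectorField.mlieBracketWithin_univ]
  exact (congrFun VectorField.mlieBracketWithin_eq_lieBracketWithin z).trans lieBracket_eq_zero

lemma mlieBracket_coordField (a b : TangentSpace (𝓡 n) x)
    (hy : y ∈ (chartAt (EuclideanSpace ℝ (Fin n)) x).source) :
    VectorField.mlieBracket (𝓡 n) (coordField a) (coordField b) y = 0 := by
  have mdiff_const (p z : EuclideanSpace ℝ (Fin n)) :
      MDifferentiableAt 𝓘(ℝ, EuclideanSpace ℝ (Fin n)) (𝓘(ℝ, EuclideanSpace ℝ (Fin n))).tangent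
        (fun z ↦ (⟨z, constField p z⟩ : TangentBundle 𝓘(ℝ, EuclideanSpace ℝ (Fin n))
          (EuclideanSpace ℝ (Fin n)))) z :=
    (contMDiffAt_vectorSpace_iff_contDiffAt.2 contDiffAt_const).mdifferentiableAt one_ne_zero
  have : IsManifold (𝓡 n) (minSmoothness ℝ 2) M := by
    rw [minSmoothness_of_isRCLikeNormedField]; infer_instance
  rw [(coordField_eventuallyEq_mpullback a hy).mlieBracket_vectorField_eq
      (coordField_eventuallyEq_mpullback b hy),
    ← VectorField.mpullback_mlieBracket (n := 2) (mdiff_const a _) (mdiff_const b _)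
      (contMDiffAt_extChartAt' hy) minSmoothness_of_isRCLikeNormedField.le]
  exact congrFun ((congrArg (VectorField.mpullback (𝓡 n) 𝓘(ℝ, EuclideanSpace ℝ (Fin n))
    (extChartAt (𝓡 n) x)) (mlieBracket_constField _ _)).trans VectorField.mpullback_zero) y

lemma exists_contMDiff_eventuallyEq [T2Space M] {σ : ∀ z : M, TangentSpace (𝓡 n) z} {s : Set M}
    (hs : IsOpen s) (hx : x ∈ s)
    (hσ : ContMDiffOn (𝓡 n) (𝓡 n).tangent ∞ (fun z ↦ (σ z : TangentBundle (𝓡 n) M)) s) :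
    ∃ σ' : ∀ z : M, TangentSpace (𝓡 n) z,
      ContMDiff (𝓡 n) (𝓡 n).tangent ∞ (fun z ↦ (σ' z : TangentBundle (𝓡 n) M)) ∧
      ∀ᶠ z in nhds x, σ' z = σ z := by
  obtain ⟨f, -, hf⟩ := (SmoothBumpFunction.nhds_basis_tsupport (I := 𝓡 n) x).mem_iff.1
    (hs.mem_nhds hx)
  refine ⟨(f : M → ℝ) • σ, ?_, ?_⟩
  · exact ContMDiffOn.smul_section_of_tsupport f.contMDiff.contMDiffOn hs hf hσ
  · filter_upwards [f.eventuallyEq_one] with z hz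
    simp [hz]

end CoordinateFields

section ChartDerivative

variable {n : ℕ} {M : Type*} [TopologicalSpace M] [ChartedSpace (EuclideanSpace ℝ (Fin n)) M]

variable (n) in
/-- The function `F` is smooth on the domain of the preferred chart at `x`. -/
def SmoothFn (x : M) (F : M → ℝ) : Prop :=
  ContMDiffOn (𝓡 n) 𝓘(ℝ) ∞ F (chartAt (EuclideanSpace ℝ (Fin n)) x).source

/-- The derivative of a function at `x` in the direction `a`, computed in the preferred chart at
`x`. Unlike `mfderiv` it is a real number on the nose, and not a vector in a tangent space. -/
def chartDeriv {x : M} (a : TangentSpace (𝓡 n) x) (F : M → ℝ) : ℝ :=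
  fderiv ℝ (F ∘ (extChartAt (𝓡 n) x).symm) (extChartAt (𝓡 n) x x) a

/-- The coordinate line through `x` with velocity `a`, in the preferred chart at `x`. -/
def chartLine {x : M} (a : TangentSpace (𝓡 n) x) (t : ℝ) : M :=
  let v : EuclideanSpace ℝ (Fin n) := a
  (extChartAt (𝓡 n) x).symm (extChartAt (𝓡 n) x x + t • v)

variable {x y : M} {F F' : M → ℝ}

lemma SmoothFn.contMDiffAt (hF : SmoothFn n x F)
    (hy : y ∈ (chartAt (EuclideanSpace ℝ (Fin n)) x).source) :
    ContMDiffAt (𝓡 n) 𝓘(ℝ) ∞ F y :=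
  ContMDiffOn.contMDiffAt hF ((chartAt (EuclideanSpace ℝ (Fin n)) x).open_source.mem_nhds hy)

lemma SmoothFn.mdifferentiableAt (hF : SmoothFn n x F)
    (hy : y ∈ (chartAt (EuclideanSpace ℝ (Fin n)) x).source) :
    MDifferentiableAt (𝓡 n) 𝓘(ℝ) F y :=
  (hF.contMDiffAt hy).mdifferentiableAt (by simp)

lemma chartLine_zero (a : TangentSpace (𝓡 n) x) : chartLine a 0 = x := by
  have line_zero (v : EuclideanSpace ℝ (Fin n)) :
      (extChartAt (𝓡 n) x).symm (extChartAt (𝓡 n) x x + (0 : ℝ) • v) = x := by simp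
  exact line_zero a

lemma chartDeriv_congr (a : TangentSpace (𝓡 n) x) (h : F =ᶠ[nhds x] F') :
    chartDeriv a F = chartDeriv a F' := by
  refine DFunLike.congr_fun (Filter.EventuallyEq.fderiv_eq ?_) a
  have hc : ContinuousAt (extChartAt (𝓡 n) x).symm (extChartAt (𝓡 n) x x) :=
    continuousAt_extChartAt_symm x
  rw [ContinuousAt, extChartAt_to_inv] at hc
  exact hc.eventually h

lemma chartDeriv_add_left (a b : TangentSpace (𝓡 n) x) (F : M → ℝ) :
    chartDeriv (a + b) F = chartDeriv a F + chartDeriv b F :=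
  map_add (fderiv ℝ (F ∘ (extChartAt (𝓡 n) x).symm) (extChartAt (𝓡 n) x x)) a b

lemma chartDeriv_smul_left (r : ℝ) (a : TangentSpace (𝓡 n) x) (F : M → ℝ) :
    chartDeriv (r • a) F = r * chartDeriv a F :=
  map_smul (fderiv ℝ (F ∘ (extChartAt (𝓡 n) x).symm) (extChartAt (𝓡 n) x x)) r a

lemma chartDeriv_const (a : TangentSpace (𝓡 n) x) (r : ℝ) : chartDeriv a (fun _ ↦ r) = 0 :=
  DFunLike.congr_fun (fderiv_const_apply (𝕜 := ℝ) (x := extChartAt (𝓡 n) x x) r) a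

lemma chartDeriv_neg (F : M → ℝ) (a : TangentSpace (𝓡 n) x) :
    chartDeriv a (fun y ↦ -F y) = -chartDeriv a F := by
  have h : fderiv ℝ (-(F ∘ (extChartAt (𝓡 n) x).symm)) (extChartAt (𝓡 n) x x)
      = -fderiv ℝ (F ∘ (extChartAt (𝓡 n) x).symm) (extChartAt (𝓡 n) x x) := fderiv_neg
  exact congrArg (fun L ↦ L a) h

variable [IsManifold (𝓡 n) ∞ M]

/-- The vector field `Y` is smooth on the domain of the preferred chart at `x`. -/
def SmoothField (x : M) (Y : ∀ y : M, TangentSpace (𝓡 n) y) : Prop :=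
  ContMDiffOn (𝓡 n) (𝓡 n).tangent ∞ (fun y ↦ (Y y : TangentBundle (𝓡 n) M))
    (chartAt (EuclideanSpace ℝ (Fin n)) x).source

section Fields

variable {Y Z : ∀ y : M, TangentSpace (𝓡 n) y}

lemma SmoothField.contMDiffAt (hY : SmoothField x Y)
    (hy : y ∈ (chartAt (EuclideanSpace ℝ (Fin n)) x).source) :
    ContMDiffAt (𝓡 n) (𝓡 n).tangent ∞ (fun y ↦ (Y y : TangentBundle (𝓡 n) M)) y :=
  ContMDiffOn.contMDiffAt hY ((chartAt (EuclideanSpace ℝ (Fin n)) x).open_source.mem_nhds hy)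

lemma SmoothField.mdifferentiableAt (hY : SmoothField x Y)
    (hy : y ∈ (chartAt (EuclideanSpace ℝ (Fin n)) x).source) :
    MDifferentiableAt (𝓡 n) (𝓡 n).tangent (fun y ↦ (Y y : TangentBundle (𝓡 n) M)) y :=
  (hY.contMDiffAt hy).mdifferentiableAt (by simp)

lemma SmoothField.add (hY : SmoothField x Y) (hZ : SmoothField x Z) :
    SmoothField x (fun y ↦ Y y + Z y) :=
  ContMDiffOn.add_section hY hZ

lemma SmoothField.sub (hY : SmoothField x Y) (hZ : SmoothField x Z) :
    SmoothField x (fun y ↦ Y y - Z y) :=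
  ContMDiffOn.sub_section hY hZ

lemma SmoothField.smul (hY : SmoothField x Y) (hF : SmoothFn n x F) :
    SmoothField x (fun y ↦ F y • Y y) :=
  ContMDiffOn.smul_section hF hY

lemma smoothField_coordField (a : TangentSpace (𝓡 n) x) : SmoothField x (coordField a) :=
  fun _ hy ↦ (contMDiffAt_coordField a hy).contMDiffWithinAt

end Fields

lemma contDiffAt_comp_chart_symm (hF : ContMDiffAt (𝓡 n) 𝓘(ℝ) ∞ F x) :
    ContDiffAt ℝ ∞ (F ∘ (extChartAt (𝓡 n) x).symm) (extChartAt (𝓡 n) x x) := by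
  have hφ := contMDiffWithinAt_extChartAt_symm_range (I := 𝓡 n) (n := ∞) x
    (mem_extChartAt_target (I := 𝓡 n) x)
  rw [ModelWithCorners.range_eq_univ, contMDiffWithinAt_univ] at hφ
  rw [← contMDiffAt_iff_contDiffAt]
  exact ContMDiffAt.comp_of_eq (y := x) hF hφ (by simp)

lemma differentiableAt_comp_chart_symm (hF : MDifferentiableAt (𝓡 n) 𝓘(ℝ) F x) :
    DifferentiableAt ℝ (F ∘ (extChartAt (𝓡 n) x).symm) (extChartAt (𝓡 n) x x) := by
  rw [← mdifferentiableAt_iff_differentiableAt]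
  exact MDifferentiableAt.comp_of_eq (I' := 𝓡 n) (y := x) _ hF
    (mdifferentiableAt_extChartAt_symm' (x := x) (mem_extChartAt_target (I := 𝓡 n) x))
    (extChartAt_to_inv x)

lemma mfderiv_eq_chartDeriv (hF : MDifferentiableAt (𝓡 n) 𝓘(ℝ) F x) (a : TangentSpace (𝓡 n) x) :
    mfderiv (𝓡 n) 𝓘(ℝ) F x a = chartDeriv a F := by
  have := mfderiv_coordField a (mem_chart_source _ x) hF
  rwa [coordField_self] at this

lemma hasDerivAt_chartLine (hF : MDifferentiableAt (𝓡 n) 𝓘(ℝ) F x) (a : TangentSpace (𝓡 n) x) :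
    HasDerivAt (fun t ↦ F (chartLine a t)) (chartDeriv a F) 0 := by
  have deriv_line (v : EuclideanSpace ℝ (Fin n)) :
      HasDerivAt (fun t : ℝ ↦ (F ∘ (extChartAt (𝓡 n) x).symm) (extChartAt (𝓡 n) x x + t • v))
        (fderiv ℝ (F ∘ (extChartAt (𝓡 n) x).symm) (extChartAt (𝓡 n) x x) v) 0 := by
    have line : HasDerivAt (fun t : ℝ ↦ extChartAt (𝓡 n) x x + t • v) v 0 := by
      simpa using ((hasDerivAt_id (0 : ℝ)).smul_const v).const_add (extChartAt (𝓡 n) x x)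
    exact (differentiableAt_comp_chart_symm hF).hasFDerivAt.comp_hasDerivAt_of_eq 0 line (by simp)
  exact deriv_line a

lemma chartDeriv_mul (hF : MDifferentiableAt (𝓡 n) 𝓘(ℝ) F x)
    (hF' : MDifferentiableAt (𝓡 n) 𝓘(ℝ) F' x) (a : TangentSpace (𝓡 n) x) :
    chartDeriv a (fun y ↦ F y * F' y) = chartDeriv a F * F' x + F x * chartDeriv a F' := by
  have h := (hasDerivAt_chartLine hF a).mul (hasDerivAt_chartLine hF' a)
  rw [chartLine_zero] at h
  exact (hasDerivAt_chartLine (hF.mul hF') a).unique h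

lemma chartDeriv_add (hF : MDifferentiableAt (𝓡 n) 𝓘(ℝ) F x)
    (hF' : MDifferentiableAt (𝓡 n) 𝓘(ℝ) F' x) (a : TangentSpace (𝓡 n) x) :
    chartDeriv a (fun y ↦ F y + F' y) = chartDeriv a F + chartDeriv a F' :=
  (hasDerivAt_chartLine (hF.add hF') a).unique
    ((hasDerivAt_chartLine hF a).add (hasDerivAt_chartLine hF' a))

lemma chartDeriv_mfderiv_coordField (hF : SmoothFn n x F) (a b : TangentSpace (𝓡 n) x) :
    chartDeriv a (fun y ↦ mfderiv (𝓡 n) 𝓘(ℝ) F y (coordField b y))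
      = fderiv ℝ (fderiv ℝ (F ∘ (extChartAt (𝓡 n) x).symm)) (extChartAt (𝓡 n) x x) a b := by
  set φ := extChartAt (𝓡 n) x with hφ
  have coordinate_expression :
      (fun y ↦ (mfderiv (𝓡 n) 𝓘(ℝ) F y (coordField b y) : ℝ)) ∘ φ.symm
        =ᶠ[nhds (φ x)] fun z ↦ fderiv ℝ (F ∘ φ.symm) z b := by
    filter_upwards [extChartAt_target_mem_nhds (I := 𝓡 n) x] with z hz
    have hy : φ.symm z ∈ (chartAt (EuclideanSpace ℝ (Fin n)) x).source := by
      simpa [hφ] using φ.map_target hz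
    have := mfderiv_coordField b hy (hF.mdifferentiableAt hy)
    rwa [← hφ, φ.right_inv hz] at this
  have hd : DifferentiableAt ℝ (fderiv ℝ (F ∘ φ.symm)) (φ x) :=
    (((contDiffAt_comp_chart_symm (hF.contMDiffAt (mem_chart_source _ x))).of_le (m := 2)
      ENat.LEInfty.out).fderiv_right (m := 1) one_add_one_eq_two.le).differentiableAt one_ne_zero
  have fderiv_apply (v w : EuclideanSpace ℝ (Fin n)) :
      fderiv ℝ (fun z ↦ fderiv ℝ (F ∘ φ.symm) z w) (φ x) v
        = fderiv ℝ (fderiv ℝ (F ∘ φ.symm)) (φ x) v w := by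
    rw [fderiv_clm_apply hd (differentiableAt_const w)]
    simp
  exact (DFunLike.congr_fun (coordinate_expression.fderiv_eq (𝕜 := ℝ)) a).trans
    (fderiv_apply a b)

lemma chartDeriv_mfderiv_comm (hF : SmoothFn n x F) (a b : TangentSpace (𝓡 n) x) :
    chartDeriv a (fun y ↦ mfderiv (𝓡 n) 𝓘(ℝ) F y (coordField b y))
      = chartDeriv b (fun y ↦ mfderiv (𝓡 n) 𝓘(ℝ) F y (coordField a y)) := by
  rw [chartDeriv_mfderiv_coordField hF, chartDeriv_mfderiv_coordField hF]
  refine (contDiffAt_comp_chart_symm (hF.contMDiffAt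
    (mem_chart_source _ x))).isSymmSndFDerivAt ?_ a b
  rw [minSmoothness_of_isRCLikeNormedField]
  exact ENat.LEInfty.out

end ChartDerivative

section Connection

variable {M : Type*} [TopologicalSpace M]
  [ChartedSpace (EuclideanSpace ℝ (Fin 4)) M] [IsManifold (𝓡 4) ∞ M]
  {x y : M} {Y Z : ∀ y : M, TangentSpace (𝓡 4) y}

lemma LorentzMetric.contMDiffAt_val (g : LorentzMetric M)
    (hY : ContMDiffAt (𝓡 4) (𝓡 4).tangent ∞ (fun y ↦ (Y y : TangentBundle (𝓡 4) M)) x)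
    (hZ : ContMDiffAt (𝓡 4) (𝓡 4).tangent ∞ (fun y ↦ (Z y : TangentBundle (𝓡 4) M)) x) :
    ContMDiffAt (𝓡 4) 𝓘(ℝ) ∞ (fun y ↦ g.val y (Y y) (Z y)) x := by
  have : ContMDiffAt (𝓡 4) ((𝓡 4).prod 𝓘(ℝ)) ∞
      (fun m ↦ Bundle.TotalSpace.mk' ℝ (E := Bundle.Trivial M ℝ) m (g.val m (Y m) (Z m))) x :=
    ContMDiffAt.clm_bundle_apply₂ (F₁ := EuclideanSpace ℝ (Fin 4))
      (F₂ := EuclideanSpace ℝ (Fin 4)) g.smooth.contMDiffAt hY hZ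
  simp only [Bundle.contMDiffAt_totalSpace] at this
  exact this.2

lemma LorentzMetric.smoothFn_val (g : LorentzMetric M) (hY : SmoothField x Y)
    (hZ : SmoothField x Z) : SmoothFn 4 x (fun y ↦ g.val y (Y y) (Z y)) :=
  fun _ hy ↦ (g.contMDiffAt_val (hY.contMDiffAt hy) (hZ.contMDiffAt hy)).contMDiffWithinAt

namespace RiemannCartan

variable (G : RiemannCartan M)

/-- The covariant derivative along a coordinate field of the chart at `x`. -/
def cov {x : M} (a : TangentSpace (𝓡 4) x) (Y : ∀ y : M, TangentSpace (𝓡 4) y) (y : M) :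
    TangentSpace (𝓡 4) y :=
  G.nabla Y y (coordField a y)

lemma cov_self (a : TangentSpace (𝓡 4) x) (Y : ∀ y : M, TangentSpace (𝓡 4) y) :
    G.cov a Y x = G.nabla Y x a := by
  rw [cov, coordField_self]

lemma smoothField_cov [T2Space M] (hY : SmoothField x Y) (a : TangentSpace (𝓡 4) x) :
    SmoothField x (G.cov a Y) := by
  intro y hy
  have hs := (chartAt (EuclideanSpace ℝ (Fin 4)) x).open_source
  obtain ⟨σ, hσ, hσY⟩ := exists_contMDiff_eventuallyEq hs hy hY
  have smooth_nabla := G.nabla_smooth.contMDiff.contMDiff (σ := σ) (by simpa using hσ.contMDiffOn)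
  have smooth_cov : ContMDiffAt (𝓡 4) (𝓡 4).tangent ∞
      (fun z ↦ (G.nabla σ z (coordField a z) : TangentBundle (𝓡 4) M)) y :=
    ContMDiffAt.clm_bundle_apply (F₁ := EuclideanSpace ℝ (Fin 4)) (F₂ := EuclideanSpace ℝ (Fin 4))
      (smooth_nabla.contMDiffAt Filter.univ_mem) (contMDiffAt_coordField a hy)
  refine (smooth_cov.congr_of_eventuallyEq ?_).contMDiffWithinAt
  filter_upwards [hσY.eventually_nhds, hs.mem_nhds hy] with z hz hzs
  have := G.nabla.isCovariantDerivativeOn.congr_of_eventuallyEq (s := Set.univ)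
    (hY.mdifferentiableAt hzs) (hσ.mdifferentiable (by simp) z) Filter.univ_mem
    (hz.mono fun _ h ↦ h.symm)
  simp only [cov, this]

lemma mfderiv_val (hY : SmoothField x Y) (hZ : SmoothField x Z) (a : TangentSpace (𝓡 4) x)
    (hy : y ∈ (chartAt (EuclideanSpace ℝ (Fin 4)) x).source) :
    mfderiv (𝓡 4) 𝓘(ℝ) (fun y ↦ G.g.val y (Y y) (Z y)) y (coordField a y)
      = G.g.val y (G.cov a Y y) (Z y) + G.g.val y (Y y) (G.cov a Z y) :=
  G.nabla_metric Y Z y (hY.mdifferentiableAt hy) (hZ.mdifferentiableAt hy) _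

lemma chartDeriv_val (hY : SmoothField x Y) (hZ : SmoothField x Z) (a : TangentSpace (𝓡 4) x) :
    chartDeriv a (fun y ↦ G.g.val y (Y y) (Z y))
      = G.g.val x (G.cov a Y x) (Z x) + G.g.val x (Y x) (G.cov a Z x) := by
  rw [← mfderiv_eq_chartDeriv ((G.g.smoothFn_val hY hZ).mdifferentiableAt (mem_chart_source _ x)),
    ← mfderiv_val G hY hZ a (mem_chart_source _ x), coordField_self]

lemma cov_add (hY : SmoothField x Y) (hZ : SmoothField x Z) (a : TangentSpace (𝓡 4) x) :
    G.cov a (fun y ↦ Y y + Z y) x = G.cov a Y x + G.cov a Z x := by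
  have := G.nabla.isCovariantDerivativeOn.add (s := Set.univ)
    (hY.mdifferentiableAt (mem_chart_source _ x)) (hZ.mdifferentiableAt (mem_chart_source _ x))
  exact congrArg (fun L ↦ L (coordField a x)) this

lemma cov_smul (hY : SmoothField x Y) {F : M → ℝ}
    (hF : MDifferentiableAt (𝓡 4) 𝓘(ℝ) F x) (a : TangentSpace (𝓡 4) x) :
    G.cov a (fun y ↦ F y • Y y) x = F x • G.cov a Y x + chartDeriv a F • Y x := by
  have := G.nabla.isCovariantDerivativeOn.leibniz (s := Set.univ)
    (hY.mdifferentiableAt (mem_chart_source _ x)) hF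
  rw [← mfderiv_eq_chartDeriv hF a, cov_self, cov_self]
  exact congrArg (fun L ↦ L a) this

lemma cov_congr (hY : SmoothField x Y) (hZ : SmoothField x Z)
    (h : ∀ y ∈ (chartAt (EuclideanSpace ℝ (Fin 4)) x).source, Y y = Z y)
    (a : TangentSpace (𝓡 4) x) : G.cov a Y x = G.cov a Z x := by
  have := G.nabla.isCovariantDerivativeOn.congr_of_eqOn
    (hY.mdifferentiableAt (mem_chart_source _ x)) (hZ.mdifferentiableAt (mem_chart_source _ x))
    ((chartAt (EuclideanSpace ℝ (Fin 4)) x).open_source.mem_nhds (mem_chart_source _ x)) h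
  simp only [cov, this]

lemma cov_coordField_sub (a b : TangentSpace (𝓡 4) x)
    (hy : y ∈ (chartAt (EuclideanSpace ℝ (Fin 4)) x).source) :
    G.cov a (coordField b) y - G.cov b (coordField a) y
      = G.nabla.torsion y (coordField a y) (coordField b y) := by
  have := G.nabla.torsion_apply ((smoothField_coordField a).mdifferentiableAt hy)
    ((smoothField_coordField b).mdifferentiableAt hy)
  rw [mlieBracket_coordField a b hy, sub_zero] at this
  exact this.symm

/-- The commutator `∇_a ∇_b Y - ∇_b ∇_a Y` at `x` of the covariant derivatives along two
coordinate fields; since these commute, it is the curvature applied to `Y`. -/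
def covCommutator {x : M} (a b : TangentSpace (𝓡 4) x) (Y : ∀ y : M, TangentSpace (𝓡 4) y) :
    TangentSpace (𝓡 4) x :=
  G.cov a (G.cov b Y) x - G.cov b (G.cov a Y) x

lemma covCommutator_swap (a b : TangentSpace (𝓡 4) x) :
    G.covCommutator a b Y = -G.covCommutator b a Y :=
  (neg_sub _ _).symm

lemma riemann_eq (a b c : TangentSpace (𝓡 4) x) :
    G.riemann x a b c = G.covCommutator b a (coordField c) := by
  have h := mlieBracket_coordField a b (mem_chart_source _ x)
  rw [riemann, curvature, h, map_zero, add_zero]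
  rfl

variable [T2Space M]

lemma chartDeriv_mfderiv_val (hY : SmoothField x Y) (hZ : SmoothField x Z)
    (a b : TangentSpace (𝓡 4) x) :
    chartDeriv a (fun y ↦ mfderiv (𝓡 4) 𝓘(ℝ) (fun y ↦ G.g.val y (Y y) (Z y)) y (coordField b y))
      = G.g.val x (G.cov a (G.cov b Y) x) (Z x) + G.g.val x (G.cov b Y x) (G.cov a Z x)
        + (G.g.val x (G.cov a Y x) (G.cov b Z x) + G.g.val x (Y x) (G.cov a (G.cov b Z) x)) := by
  have hx := mem_chart_source (EuclideanSpace ℝ (Fin 4)) x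
  have hbY := G.smoothField_cov hY b
  have hbZ := G.smoothField_cov hZ b
  have first_derivative :
      (fun y ↦ (mfderiv (𝓡 4) 𝓘(ℝ) (fun y ↦ G.g.val y (Y y) (Z y)) y (coordField b y) : ℝ))
        =ᶠ[nhds x] fun y ↦ G.g.val y (G.cov b Y y) (Z y) + G.g.val y (Y y) (G.cov b Z y) := by
    filter_upwards [(chartAt (EuclideanSpace ℝ (Fin 4)) x).open_source.mem_nhds hx] with y hy
      using G.mfderiv_val hY hZ b hy
  rw [← G.chartDeriv_val hbY hZ, ← G.chartDeriv_val hY hbZ]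
  exact (chartDeriv_congr a first_derivative).trans
    (chartDeriv_add ((G.g.smoothFn_val hbY hZ).mdifferentiableAt hx)
      ((G.g.smoothFn_val hY hbZ).mdifferentiableAt hx) a)

lemma val_covCommutator (hY : SmoothField x Y) (hZ : SmoothField x Z)
    (a b : TangentSpace (𝓡 4) x) :
    G.g.val x (G.covCommutator a b Y) (Z x) = -G.g.val x (Y x) (G.covCommutator a b Z) := by
  have hc := chartDeriv_mfderiv_comm (G.g.smoothFn_val hY hZ) a b
  rw [G.chartDeriv_mfderiv_val hY hZ, G.chartDeriv_mfderiv_val hY hZ] at hc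
  simp only [covCommutator, map_sub, sub_apply]
  linarith

lemma covCommutator_add_left (hY : SmoothField x Y) (a a' b : TangentSpace (𝓡 4) x) :
    G.covCommutator (a + a') b Y = G.covCommutator a b Y + G.covCommutator a' b Y := by
  have ha := G.smoothField_cov hY a
  have ha' := G.smoothField_cov hY a'
  have cov_add_field : G.cov b (G.cov (a + a') Y) x
      = G.cov b (G.cov a Y) x + G.cov b (G.cov a' Y) x := by
    rw [← G.cov_add ha ha']
    refine G.cov_congr (G.smoothField_cov hY _) (ha.add ha') (fun y hy ↦ ?_) b
    rw [cov, coordField_add _ _ hy, map_add]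
    rfl
  simp only [covCommutator, cov_add_field, cov_self G (a + a'), cov_self G a (G.cov b Y),
    cov_self G a' (G.cov b Y), map_add]
  abel

lemma covCommutator_smul_left (hY : SmoothField x Y) (r : ℝ) (a b : TangentSpace (𝓡 4) x) :
    G.covCommutator (r • a) b Y = r • G.covCommutator a b Y := by
  have ha := G.smoothField_cov hY a
  have smooth_const : SmoothFn 4 x (fun _ : M ↦ r) := contMDiffOn_const
  have cov_smul_field : G.cov b (G.cov (r • a) Y) x = r • G.cov b (G.cov a Y) x := by
    have h := G.cov_smul ha (F := fun _ ↦ r) mdifferentiableAt_const b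
    rw [chartDeriv_const, zero_smul, add_zero] at h
    rw [← h]
    refine G.cov_congr (G.smoothField_cov hY _) (ha.smul smooth_const) (fun y hy ↦ ?_) b
    rw [cov, coordField_smul _ _ hy, map_smul]
    rfl
  simp only [covCommutator, cov_smul_field, cov_self G (r • a), cov_self G a (G.cov b Y),
    map_smul, smul_sub]

lemma ricci_eq_sum {e : Module.Basis (Fin 4) ℝ (TangentSpace (𝓡 4) x)} (he : G.g.IsOrthonormal e)
    (a b : TangentSpace (𝓡 4) x) :
    G.ricci x a b = ∑ i, eta i * G.g.val x (G.covCommutator (e i) a (coordField b)) (e i) := by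
  have hb := smoothField_coordField b
  let B : TangentSpace (𝓡 4) x →ₗ[ℝ] TangentSpace (𝓡 4) x →ₗ[ℝ] ℝ :=
    LinearMap.mk₂ ℝ (fun c d ↦ G.g.val x (G.covCommutator c a (coordField b)) d)
      (fun c c' d ↦ by simp [G.covCommutator_add_left hb])
      (fun r c d ↦ by simp [G.covCommutator_smul_left hb])
      (fun c d d' ↦ map_add _ d d') (fun r c d ↦ map_smul _ r d)
  have trace := (G.frame_isOrthonormal x).trace_eq he B
  simp only [B, LinearMap.mk₂_apply] at trace
  rw [← trace, ricci]
  simp only [G.riemann_eq]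

end RiemannCartan

end Connection

section SpatialTensors

variable {M : Type*} [TopologicalSpace M]
  [ChartedSpace (EuclideanSpace ℝ (Fin 4)) M] [IsManifold (𝓡 4) ∞ M] {x : M}

namespace RiemannCartan

variable (G : RiemannCartan M) {u : ∀ x : M, TangentSpace (𝓡 4) x}

lemma smoothFn_h (hu : SmoothField x u) (a b : TangentSpace (𝓡 4) x) :
    SmoothFn 4 x (fun y ↦ G.h u y (coordField a y) (coordField b y)) :=
  (G.g.smoothFn_val (smoothField_coordField a) (smoothField_coordField b)).add
    ((G.g.smoothFn_val hu (smoothField_coordField a)).mul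
      (G.g.smoothFn_val hu (smoothField_coordField b)))

lemma contMDiffAt_eps (hu : SmoothField x u) (a b d : TangentSpace (𝓡 4) x) :
    ContMDiffAt (𝓡 4) 𝓘(ℝ) ∞
      (fun y ↦ G.eps u y (coordField a y) (coordField b y) (coordField d y)) x := by
  have hx := mem_chart_source (EuclideanSpace ℝ (Fin 4)) x
  have h := G.vol_smooth ![coordField a, coordField b, coordField d, u] x (by
    intro i
    fin_cases i
    exacts [contMDiffAt_coordField a hx, contMDiffAt_coordField b hx, contMDiffAt_coordField d hx,
      hu.contMDiffAt hx])
  convert h using 2 with y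
  refine congrArg (G.vol y) ?_
  funext i
  fin_cases i <;> rfl

lemma chartDeriv_h (hu : SmoothField x u) {a b : TangentSpace (𝓡 4) x}
    (ha : G.g.val x (u x) a = 0) (hb : G.g.val x (u x) b = 0) (l : TangentSpace (𝓡 4) x) :
    chartDeriv l (fun y ↦ G.h u y (coordField a y) (coordField b y))
      = G.h u x (G.cov l (coordField a) x) b + G.h u x a (G.cov l (coordField b) x) := by
  have hx := mem_chart_source (EuclideanSpace ℝ (Fin 4)) x
  have hab := (G.g.smoothFn_val (smoothField_coordField a)
    (smoothField_coordField b)).mdifferentiableAt hx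
  have hua := (G.g.smoothFn_val hu (smoothField_coordField a)).mdifferentiableAt hx
  have hub := (G.g.smoothFn_val hu (smoothField_coordField b)).mdifferentiableAt hx
  have sum_rule := chartDeriv_add hab (hua.mul hub) l
  have product_rule := chartDeriv_mul hua hub l
  rw [coordField_self, coordField_self, ha, hb, mul_zero, zero_mul, add_zero] at product_rule
  rw [G.chartDeriv_val (smoothField_coordField a) (smoothField_coordField b), coordField_self,
    coordField_self] at sum_rule
  simp only [h, ha, hb, mul_zero, zero_mul, add_zero]
  exact sum_rule.trans ((congrArg _ product_rule).trans (add_zero _))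

-- Obtained by differentiating `ε_{αβδ}²`, which is a determinant of components of `h`.
lemma chartDeriv_eps (hu : SmoothField x u) (unit : ∀ y, G.g.val y (u y) (u y) = -1)
    {a b d : TangentSpace (𝓡 4) x} (ha : G.g.val x (u x) a = 0) (hb : G.g.val x (u x) b = 0)
    (hd : G.g.val x (u x) d = 0) (heps : G.eps u x a b d ≠ 0) (l : TangentSpace (𝓡 4) x) :
    chartDeriv l (fun y ↦ G.eps u y (coordField a y) (coordField b y) (coordField d y))
      = G.eps u x (G.cov l (coordField a) x) b d + G.eps u x a (G.cov l (coordField b) x) d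
        + G.eps u x a b (G.cov l (coordField d) x) := by
  have hx := mem_chart_source (EuclideanSpace ℝ (Fin 4)) x
  have deriv_eps :=
    hasDerivAt_chartLine ((G.contMDiffAt_eps hu a b d).mdifferentiableAt (by simp)) l
  have deriv_h {v w : TangentSpace (𝓡 4) x} (hv : G.g.val x (u x) v = 0)
      (hw : G.g.val x (u x) w = 0) :=
    G.chartDeriv_h hu hv hw l ▸
      hasDerivAt_chartLine ((G.smoothFn_h hu v w).mdifferentiableAt hx) l
  have deriv_eps_sq := deriv_eps.mul deriv_eps
  have deriv_det :=
    (((deriv_h ha ha).mul (((deriv_h hb hb).mul (deriv_h hd hd)).sub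
      ((deriv_h hb hd).mul (deriv_h hd hb)))).add
    ((deriv_h hb ha).mul (((deriv_h hd hb).mul (deriv_h ha hd)).sub
      ((deriv_h hd hd).mul (deriv_h ha hb))))).add
    ((deriv_h hd ha).mul (((deriv_h ha hb).mul (deriv_h hb hd)).sub
      ((deriv_h ha hd).mul (deriv_h hb hb))))
  have deriv_eq := (deriv_eps_sq.congr_of_eventuallyEq (.of_forall fun t ↦
    (G.eps_mul_eps u (unit _) _ _ _ _ _ _).symm)).unique deriv_det
  simp only [Pi.mul_apply, Pi.sub_apply] at deriv_eq
  rw [chartLine_zero] at deriv_eq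
  simp only [coordField_self] at deriv_eq
  set a' := G.cov l (coordField a) x
  set b' := G.cov l (coordField b) x
  set d' := G.cov l (coordField d) x
  refine mul_left_cancel₀ heps ?_
  rw [mul_add, mul_add, G.eps_mul_eps u (unit x), G.eps_mul_eps u (unit x),
    G.eps_mul_eps u (unit x)]
  simp only [G.h_comm u x b a, G.h_comm u x d a, G.h_comm u x d b, G.h_comm u x a' _,
    G.h_comm u x b' _, G.h_comm u x d' _] at deriv_eq ⊢
  linear_combination deriv_eq / 2

end RiemannCartan

end SpatialTensors

section SpinCongruence

variable {M : Type*} [TopologicalSpace M]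
  [ChartedSpace (EuclideanSpace ℝ (Fin 4)) M] [IsManifold (𝓡 4) ∞ M] {x : M}

namespace RiemannCartan

variable {G : RiemannCartan M} {u : ∀ x : M, TangentSpace (𝓡 4) x}

lemma torsionTwo_add_left (a a' b : TangentSpace (𝓡 4) x) :
    G.torsionTwo u x (a + a') b = G.torsionTwo u x a b + G.torsionTwo u x a' b := by
  simp only [torsionTwo, torsionTensor, map_add, map_smul, add_apply, smul_eq_mul, smul_apply]
  ring

lemma torsionTwo_smul_left (r : ℝ) (a b : TangentSpace (𝓡 4) x) :
    G.torsionTwo u x (r • a) b = r * G.torsionTwo u x a b := by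
  simp only [torsionTwo, torsionTensor, map_smul, smul_eq_mul, smul_apply]
  ring

lemma torsionTwo_sub_left (a a' b : TangentSpace (𝓡 4) x) :
    G.torsionTwo u x (a - a') b = G.torsionTwo u x a b - G.torsionTwo u x a' b := by
  simp only [torsionTwo, torsionTensor, map_sub, map_smul, sub_apply, smul_eq_mul, smul_apply]
  ring

lemma torsionTwo_smul_self_left (unit : G.g.val x (u x) (u x) = -1) (r : ℝ)
    (b : TangentSpace (𝓡 4) x) : G.torsionTwo u x (r • u x) b = 0 := by
  simp [torsionTwo, torsionTensor, proj_apply, unit]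

lemma torsionTwo_self_left (unit : G.g.val x (u x) (u x) = -1) (b : TangentSpace (𝓡 4) x) :
    G.torsionTwo u x (u x) b = 0 := by
  simpa using torsionTwo_smul_self_left unit 1 b

variable (G u) in
/-- A congruence of curves with unit tangent `u` carrying torsion `S_{αβ}{}^γ = S_{αβ} u^γ`, as
produced by a spin density through the Cartan equation: it is geodesic and shear-free, with
spatially constant expansion and vorticity `S_{αβ}`, and `u^α R_{αβ} h^β{}_γ = 0`. -/
structure IsSpinCongruence : Prop where
  smooth : ContMDiff (𝓡 4) (𝓡 4).tangent ∞ (fun x ↦ (u x : TangentBundle (𝓡 4) M))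
  unit : ∀ x, G.g.val x (u x) (u x) = -1
  torsion_eq : ∀ (x : M) (a b : TangentSpace (𝓡 4) x),
    G.nabla.torsion x a b = (2 * G.torsionTwo u x a b) • u x
  acceleration_free : ∀ x, G.nabla u x (u x) = 0
  shear_free : ∀ (x : M) (a b : TangentSpace (𝓡 4) x), G.shear u x a b = 0
  expansion_homogeneous : G.NoSpatialGradient u (G.expansion u)
  vorticity_eq : ∀ (x : M) (a b : TangentSpace (𝓡 4) x),
    G.vorticity u x a b = G.torsionTwo u x a b
  ricci_eq_zero : ∀ (x : M) (b : TangentSpace (𝓡 4) x), G.g.val x (u x) b = 0 →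
    G.ricci x (u x) b = 0

variable (G u) in
/-- The covariant derivative `∇_l S_{ab}` of the two-form `S_{αβ}`. -/
def nablaTorsionTwo {x : M} (l a b : TangentSpace (𝓡 4) x) : ℝ :=
  chartDeriv l (fun y ↦ G.torsionTwo u y (coordField a y) (coordField b y))
    - G.torsionTwo u x (G.cov l (coordField a) x) b
    - G.torsionTwo u x a (G.cov l (coordField b) x)

lemma nablaTorsionTwo_self_right (l a : TangentSpace (𝓡 4) x) :
    G.nablaTorsionTwo u l a a = 0 := by
  simp only [nablaTorsionTwo, torsionTwo_self, chartDeriv_const]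
  rw [G.torsionTwo_swap u x a]
  ring

lemma nablaTorsionTwo_swap (l a b : TangentSpace (𝓡 4) x) :
    G.nablaTorsionTwo u l a b = -G.nablaTorsionTwo u l b a := by
  simp only [nablaTorsionTwo, G.torsionTwo_swap u _ _ (coordField b _), chartDeriv_neg,
    G.torsionTwo_swap u x _ b, G.torsionTwo_swap u x a]
  ring

namespace IsSpinCongruence

variable (hu : G.IsSpinCongruence u)
include hu

lemma smoothField (x : M) : SmoothField x u :=
  hu.smooth.contMDiffOn

lemma val_nabla_self (a : TangentSpace (𝓡 4) x) : G.g.val x (G.nabla u x a) (u x) = 0 := by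
  have hd := hu.smooth.mdifferentiable (by simp) x
  have h := G.nabla_metric u u x hd hd a
  rw [show (fun y ↦ G.g.val y (u y) (u y)) = fun _ ↦ (-1 : ℝ) from funext hu.unit, mfderiv_const,
    G.g.symm x (u x) (G.nabla u x a)] at h
  have h : (0 : ℝ) = _ := h
  linarith

lemma val_nabla (a b : TangentSpace (𝓡 4) x) :
    G.g.val x (G.nabla u x a) b
      = G.expansion u x / 3 * G.h u x a b + G.torsionTwo u x a b := by
  have sepPerp_eq (a b : TangentSpace (𝓡 4) x) :
      G.sepPerp u x a b = G.g.val x (G.nabla u x a) b := by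
    simp [sepPerp, sepTensor, hu.torsion_eq, torsionTwo_self_left (hu.unit x), proj_apply,
      hu.acceleration_free, hu.val_nabla_self]
  have symmetric_part := hu.shear_free x a b
  have skew_part := hu.vorticity_eq x a b
  rw [shear, sepPerp_eq, sepPerp_eq] at symmetric_part
  rw [vorticity, sepPerp_eq, sepPerp_eq] at skew_part
  linarith

variable [T2Space M]

lemma smoothFn_torsionTwo (a b : TangentSpace (𝓡 4) x) :
    SmoothFn 4 x (fun y ↦ G.torsionTwo u y (coordField a y) (coordField b y)) := by
  have smooth_sub := (G.smoothField_cov (smoothField_coordField b) a).sub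
    (G.smoothField_cov (smoothField_coordField a) b)
  refine (contMDiffOn_const (c := (-(1 / 2) : ℝ))).mul
    (G.g.smoothFn_val smooth_sub (hu.smoothField x)) |>.congr fun y hy ↦ ?_
  simp only [Pi.mul_apply, G.cov_coordField_sub a b hy, hu.torsion_eq, map_smul, smul_apply,
    hu.unit, smul_eq_mul]
  ring

lemma mdifferentiableAt_expansion (x : M) :
    MDifferentiableAt (𝓡 4) 𝓘(ℝ) (G.expansion u) x := by
  obtain ⟨f, hf, hf0⟩ := G.g.exists_isOrthonormal_zero_eq (hu.unit x)
  have hx := mem_chart_source (EuclideanSpace ℝ (Fin 4)) x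
  have h_ne : G.h u x (coordField (f 1) x) (coordField (f 1) x) ≠ 0 := by
    simp [h, ← hf0, hf _ _, eta]
  have smooth_val := (G.g.smoothFn_val (G.smoothField_cov (hu.smoothField x) (f 1))
    (smoothField_coordField (f 1))).contMDiffAt hx
  have smooth_h := (G.smoothFn_h (hu.smoothField x) (f 1) (f 1)).contMDiffAt hx
  have smooth_quotient := (contMDiffAt_const (c := (3 : ℝ))).mul (smooth_val.div₀ smooth_h h_ne)
  refine (smooth_quotient.congr_of_eventuallyEq ?_).mdifferentiableAt (by simp)
  filter_upwards [smooth_h.continuousAt.eventually_ne h_ne] with y hy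
  simp only [Pi.mul_apply, Pi.div_apply, cov, hu.val_nabla, torsionTwo_self]
  field_simp
  ring

lemma chartDeriv_expansion {a : TangentSpace (𝓡 4) x} (ha : G.g.val x (u x) a = 0) :
    chartDeriv a (G.expansion u) = 0 := by
  have h := hu.expansion_homogeneous x a
  rw [proj_apply, ha, zero_smul, add_zero,
    mfderiv_eq_chartDeriv (hu.mdifferentiableAt_expansion x)] at h
  exact h

lemma val_cov_cov {a b c : TangentSpace (𝓡 4) x} (ha : G.g.val x (u x) a = 0)
    (hb : G.g.val x (u x) b = 0) (hc : G.g.val x (u x) c = 0) :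
    G.g.val x (G.cov a (G.cov b u) x) c
      = G.expansion u x / 3 * G.h u x (G.cov a (coordField b) x) c
        + G.torsionTwo u x (G.cov a (coordField b) x) c + G.nablaTorsionTwo u a b c := by
  have hx := mem_chart_source (EuclideanSpace ℝ (Fin 4)) x
  have hus := hu.smoothField x
  have hθ : MDifferentiableAt (𝓡 4) 𝓘(ℝ) (fun y ↦ 1 / 3 * G.expansion u y) x :=
    mdifferentiableAt_const.mul (hu.mdifferentiableAt_expansion x)
  have hh := (G.smoothFn_h hus b c).mdifferentiableAt hx
  have hT := (hu.smoothFn_torsionTwo b c).mdifferentiableAt hx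
  have deriv_val := G.chartDeriv_val (G.smoothField_cov hus b) (smoothField_coordField c) a
  have deriv_θ : chartDeriv a (fun y ↦ 1 / 3 * G.expansion u y) = 0 := by
    rw [chartDeriv_mul mdifferentiableAt_const (hu.mdifferentiableAt_expansion x),
      chartDeriv_const, hu.chartDeriv_expansion ha]
    ring
  have decomposition : (fun y ↦ G.g.val y (G.cov b u y) (coordField c y)) = fun y ↦
      1 / 3 * G.expansion u y * G.h u y (coordField b y) (coordField c y)
        + G.torsionTwo u y (coordField b y) (coordField c y) := by
    funext y
    rw [cov, hu.val_nabla]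
    ring
  have hθh : MDifferentiableAt (𝓡 4) 𝓘(ℝ)
      (fun y ↦ 1 / 3 * G.expansion u y * G.h u y (coordField b y) (coordField c y)) x := hθ.mul hh
  have product_rule := chartDeriv_mul hθ hh a
  rw [deriv_θ, G.chartDeriv_h hus hb hc, coordField_self, coordField_self] at product_rule
  rw [decomposition, chartDeriv_add hθh hT, product_rule, G.cov_self b u, coordField_self,
    hu.val_nabla] at deriv_val
  rw [nablaTorsionTwo]
  linarith

lemma val_covCommutator_self {a b c : TangentSpace (𝓡 4) x} (ha : G.g.val x (u x) a = 0)
    (hb : G.g.val x (u x) b = 0) (hc : G.g.val x (u x) c = 0) :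
    G.g.val x (G.covCommutator a b u) c
      = G.nablaTorsionTwo u a b c - G.nablaTorsionTwo u b a c := by
  have cov_sub := G.cov_coordField_sub a b (mem_chart_source _ x)
  rw [hu.torsion_eq, coordField_self, coordField_self] at cov_sub
  have torsionTwo_cov_sub : G.torsionTwo u x (G.cov a (coordField b) x) c
      - G.torsionTwo u x (G.cov b (coordField a) x) c = 0 := by
    rw [← torsionTwo_sub_left, cov_sub, torsionTwo_smul_self_left (hu.unit x)]
  have h_cov_sub : G.h u x (G.cov a (coordField b) x) c
      - G.h u x (G.cov b (coordField a) x) c = 0 := by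
    simp only [h, hc, mul_zero, add_zero, ← sub_apply, ← map_sub, cov_sub, map_smul, smul_apply,
      smul_zero]
  rw [covCommutator, map_sub, sub_apply, hu.val_cov_cov ha hb hc, hu.val_cov_cov hb ha hc]
  linear_combination G.expansion u x / 3 * h_cov_sub + torsionTwo_cov_sub

lemma val_cov_cov_coordField_sub {d : TangentSpace (𝓡 4) x} (hd : G.g.val x (u x) d = 0)
    (a b c : TangentSpace (𝓡 4) x) :
    G.g.val x (G.cov c (G.cov a (coordField b)) x) d
        - G.g.val x (G.cov c (G.cov b (coordField a)) x) d
      = 2 * G.torsionTwo u x a b * G.g.val x (G.nabla u x c) d := by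
  have hus := hu.smoothField x
  have hba := G.smoothField_cov (smoothField_coordField a) b
  have hT : SmoothFn 4 x (fun y ↦ 2 * G.torsionTwo u y (coordField a y) (coordField b y)) :=
    contMDiffOn_const.mul (hu.smoothFn_torsionTwo a b)
  have cov_torsion := G.cov_smul hus (hT.mdifferentiableAt (mem_chart_source _ x)) c
  have cov_eq : G.cov c (G.cov a (coordField b)) x = G.cov c (fun y ↦ G.cov b (coordField a) y
      + (2 * G.torsionTwo u y (coordField a y) (coordField b y)) • u y) x := by
    refine G.cov_congr (G.smoothField_cov (smoothField_coordField b) a)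
      (hba.add (hus.smul hT)) (fun y hy ↦ ?_) c
    rw [← hu.torsion_eq, ← G.cov_coordField_sub a b hy]
    abel
  rw [cov_eq, G.cov_add hba (hus.smul hT), cov_torsion]
  simp only [map_add, map_smul, add_apply, smul_apply, hd, smul_eq_mul, mul_zero, cov_self,
    coordField_self]
  ring

lemma bianchi {d : TangentSpace (𝓡 4) x} (hd : G.g.val x (u x) d = 0)
    (a b c : TangentSpace (𝓡 4) x) :
    G.g.val x (G.covCommutator a b (coordField c)) d
        + G.g.val x (G.covCommutator b c (coordField a)) d
        + G.g.val x (G.covCommutator c a (coordField b)) d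
      = 2 * (G.torsionTwo u x b c * G.g.val x (G.nabla u x a) d
        + G.torsionTwo u x c a * G.g.val x (G.nabla u x b) d
        + G.torsionTwo u x a b * G.g.val x (G.nabla u x c) d) := by
  simp only [covCommutator, map_sub, sub_apply]
  linear_combination hu.val_cov_cov_coordField_sub hd b c a
    + hu.val_cov_cov_coordField_sub hd c a b + hu.val_cov_cov_coordField_sub hd a b c

lemma val_covCommutator_coordField {a : TangentSpace (𝓡 4) x} (ha : G.g.val x (u x) a = 0)
    (b : TangentSpace (𝓡 4) x) :
    G.g.val x (G.covCommutator a (u x) (coordField b)) a = G.g.val x (G.covCommutator a b u) a := by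
  have hsa := smoothField_coordField a
  have cyclic := hu.bianchi ha a (u x) b
  rw [torsionTwo_self_left (hu.unit x), G.torsionTwo_swap u x a (u x),
    torsionTwo_self_left (hu.unit x), hu.acceleration_free] at cyclic
  have skew_a := G.val_covCommutator hsa hsa (u x) b
  have skew_u := G.val_covCommutator (hu.smoothField x) hsa a b
  have skew_field := G.val_covCommutator (smoothField_coordField (u x)) hsa a b
  have swap := G.covCommutator_swap (Y := coordField (u x)) a b
  rw [G.g.symm x (coordField a x)] at skew_a
  simp only [coordField_self] at skew_a skew_u skew_field
  rw [skew_u, ← skew_field, swap]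
  simp only [map_zero, zero_apply, map_neg, neg_apply] at cyclic ⊢
  linarith

end IsSpinCongruence

end RiemannCartan

end SpinCongruence

section TorsionVector

variable {M : Type*} [TopologicalSpace M]
  [ChartedSpace (EuclideanSpace ℝ (Fin 4)) M] [IsManifold (𝓡 4) ∞ M] {x : M}

namespace RiemannCartan

variable {G : RiemannCartan M} {u : ∀ x : M, TangentSpace (𝓡 4) x}

variable (G u) in
/-- The covariant derivative `∇_l S_c` of the torsion vector. -/
def nablaTorsionVector {x : M} (l c : TangentSpace (𝓡 4) x) : ℝ :=
  chartDeriv l (fun y ↦ G.g.val y (G.torsionVector u y) (coordField c y))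
    - G.g.val x (G.torsionVector u x) (G.cov l (coordField c) x)

section AdaptedBasis

variable {f : Module.Basis (Fin 4) ℝ (TangentSpace (𝓡 4) x)}

lemma val_succ_eq_zero (hf : G.g.IsOrthonormal f) (hf0 : f 0 = u x) (i : Fin 3) :
    G.g.val x (u x) (f i.succ) = 0 := by
  rw [← hf0, hf, if_neg (Fin.succ_ne_zero i).symm]

lemma eps_ne_zero (hf : G.g.IsOrthonormal f) (hf0 : f 0 = u x) :
    G.eps u x (f 1) (f 2) (f 3) ≠ 0 := by
  have eps_sq := G.eps_mul_eps u (x := x) (by rw [← hf0, hf]; simp [eta])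
    (f 1) (f 2) (f 3) (f 1) (f 2) (f 3)
  intro h0
  simp [h0, h, ← hf0, hf _ _, eta] at eps_sq

lemma nablaTorsionTwo_eq_sum (hf : G.g.IsOrthonormal f) (hf0 : f 0 = u x)
    {l : TangentSpace (𝓡 4) x} (hl : G.g.val x (u x) l = 0) (a b : TangentSpace (𝓡 4) x) :
    G.nablaTorsionTwo u l a b
      = ∑ i : Fin 3, G.g.val x l (f i.succ) * G.nablaTorsionTwo u (f i.succ) a b := by
  let L : TangentSpace (𝓡 4) x →ₗ[ℝ] ℝ :=
    { toFun l := G.nablaTorsionTwo u l a b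
      map_add' l l' := by
        simp only [nablaTorsionTwo, cov_self, chartDeriv_add_left, map_add, torsionTwo_add_left,
          G.torsionTwo_swap u x a]
        ring
      map_smul' r l := by
        simp only [nablaTorsionTwo, cov_self, chartDeriv_smul_left, map_smul, torsionTwo_smul_left,
          G.torsionTwo_swap u x a, smul_eq_mul, RingHom.id_apply]
        ring }
  have hL : ∑ i, eta i * G.g.val x l (f i) * L (f i) = L l := hf.sum_apply L l
  rw [Fin.sum_univ_succ, hf0, G.g.symm x l, hl, mul_zero, zero_mul, zero_add] at hL
  simpa [eta, L] using hL.symm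

end AdaptedBasis

namespace IsSpinCongruence

variable (hu : G.IsSpinCongruence u)
include hu
variable [T2Space M]

lemma sum_nablaTorsionTwo {f : Module.Basis (Fin 4) ℝ (TangentSpace (𝓡 4) x)}
    (hf : G.g.IsOrthonormal f) (hf0 : f 0 = u x) {b : TangentSpace (𝓡 4) x}
    (hb : G.g.val x (u x) b = 0) :
    ∑ i : Fin 3, G.nablaTorsionTwo u (f i.succ) b (f i.succ) = 0 := by
  have commutator_zero : G.covCommutator (u x) (u x) (coordField b) = 0 := sub_self _
  have ricci_sum := G.ricci_eq_sum hf (u x) b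
  rw [hu.ricci_eq_zero x b hb, Fin.sum_univ_succ, hf0, commutator_zero, map_zero, zero_apply,
    mul_zero, zero_add] at ricci_sum
  rw [ricci_sum]
  refine Finset.sum_congr rfl fun i _ ↦ ?_
  have hi := val_succ_eq_zero hf hf0 i
  rw [hu.val_covCommutator_coordField hi, hu.val_covCommutator_self hi hb hi,
    nablaTorsionTwo_self_right]
  simp [eta]

lemma contMDiffAt_val_torsionVector (c : TangentSpace (𝓡 4) x) :
    ContMDiffAt (𝓡 4) 𝓘(ℝ) ∞
      (fun y ↦ G.g.val y (G.torsionVector u y) (coordField c y)) x := by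
  obtain ⟨f, hf, hf0⟩ := G.g.exists_isOrthonormal_zero_eq (hu.unit x)
  have hx := mem_chart_source (EuclideanSpace ℝ (Fin 4)) x
  have hus := hu.smoothField x
  have smooth_eps := G.contMDiffAt_eps hus (f 1) (f 2) (f 3)
  have eps_ne : G.eps u x (coordField (f 1) x) (coordField (f 2) x) (coordField (f 3) x) ≠ 0 := by
    simpa only [coordField_self] using eps_ne_zero hf hf0
  have smooth_dual (v w z : TangentSpace (𝓡 4) x) :=
    ((hu.smoothFn_torsionTwo v w).contMDiffAt hx).mul ((G.smoothFn_h hus z c).contMDiffAt hx)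
  have smooth_quotient := (((smooth_dual (f 2) (f 3) (f 1)).add
    (smooth_dual (f 3) (f 1) (f 2))).add (smooth_dual (f 1) (f 2) (f 3))).div₀ smooth_eps eps_ne
  refine smooth_quotient.congr_of_eventuallyEq ?_
  filter_upwards [smooth_eps.continuousAt.eventually_ne eps_ne] with y hy
  rw [Pi.div_apply, eq_div_iff hy, mul_comm]
  exact G.eps_mul_val_torsionVector u (hu.unit y) _ _ _ _

lemma eps_mul_nablaTorsionVector {a b d c : TangentSpace (𝓡 4) x}
    (ha : G.g.val x (u x) a = 0) (hb : G.g.val x (u x) b = 0) (hd : G.g.val x (u x) d = 0)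
    (hc : G.g.val x (u x) c = 0) (heps : G.eps u x a b d ≠ 0) (l : TangentSpace (𝓡 4) x) :
    G.eps u x a b d * G.nablaTorsionVector u l c
      = G.nablaTorsionTwo u l b d * G.h u x a c + G.nablaTorsionTwo u l d a * G.h u x b c
        + G.nablaTorsionTwo u l a b * G.h u x d c := by
  have hx := mem_chart_source (EuclideanSpace ℝ (Fin 4)) x
  have hus := hu.smoothField x
  have deriv_eps := G.chartDeriv_eps hus hu.unit ha hb hd heps l ▸
    hasDerivAt_chartLine ((G.contMDiffAt_eps hus a b d).mdifferentiableAt (by simp)) l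
  have deriv_form := hasDerivAt_chartLine
    ((hu.contMDiffAt_val_torsionVector c).mdifferentiableAt (by simp)) l
  have deriv_torsion (v w : TangentSpace (𝓡 4) x) :=
    hasDerivAt_chartLine ((hu.smoothFn_torsionTwo v w).mdifferentiableAt hx) l
  have deriv_h {v : TangentSpace (𝓡 4) x} (hv : G.g.val x (u x) v = 0) :=
    G.chartDeriv_h hus hv hc l ▸
      hasDerivAt_chartLine ((G.smoothFn_h hus v c).mdifferentiableAt hx) l
  have deriv_rhs := (((deriv_torsion b d).mul (deriv_h ha)).add
    ((deriv_torsion d a).mul (deriv_h hb))).add ((deriv_torsion a b).mul (deriv_h hd))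
  have deriv_eq := ((deriv_eps.mul deriv_form).congr_of_eventuallyEq (.of_forall fun t ↦
    (G.eps_mul_val_torsionVector u (hu.unit _) _ _ _ _).symm)).unique deriv_rhs
  rw [chartLine_zero] at deriv_eq
  simp only [coordField_self] at deriv_eq
  have dual := G.eps_mul_val_torsionVector u (hu.unit x)
  simp only [nablaTorsionVector, nablaTorsionTwo]
  linear_combination deriv_eq - dual (G.cov l (coordField a) x) b d c
    - dual a (G.cov l (coordField b) x) d c - dual a b (G.cov l (coordField d) x) c
    - dual a b d (G.cov l (coordField c) x)

lemma nablaTorsionVector_comm {a b : TangentSpace (𝓡 4) x} (ha : G.g.val x (u x) a = 0)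
    (hb : G.g.val x (u x) b = 0) : G.nablaTorsionVector u a b = G.nablaTorsionVector u b a := by
  obtain ⟨f, hf, hf0⟩ := G.g.exists_isOrthonormal_zero_eq (hu.unit x)
  have spatial := val_succ_eq_zero hf hf0
  have heps : G.eps u x (f (Fin.succ 0)) (f (Fin.succ 1)) (f (Fin.succ 2)) ≠ 0 :=
    eps_ne_zero hf hf0
  have h_eq {c : TangentSpace (𝓡 4) x} (i : Fin 3) :
      G.h u x (f i.succ) c = G.g.val x c (f i.succ) := by
    rw [h, spatial, zero_mul, add_zero, G.g.symm]
  have dual (l : TangentSpace (𝓡 4) x) {c : TangentSpace (𝓡 4) x} (hc : G.g.val x (u x) c = 0) :=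
    hu.eps_mul_nablaTorsionVector (spatial 0) (spatial 1) (spatial 2) hc heps l
  have divergence (i : Fin 3) := hu.sum_nablaTorsionTwo hf hf0 (spatial i)
  have swap (l : TangentSpace (𝓡 4) x) (i j : Fin 3) :=
    nablaTorsionTwo_swap (G := G) (u := u) l (f i.succ) (f j.succ)
  have div_zero := divergence 0
  have div_one := divergence 1
  have div_two := divergence 2
  refine mul_left_cancel₀ heps ?_
  rw [dual a hb, dual b ha]
  obtain ⟨e, he⟩ : ∃ e : Fin 3 → TangentSpace (𝓡 4) x, ∀ i, f i.succ = e i := ⟨_, fun _ ↦ rfl⟩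
  simp only [nablaTorsionTwo_eq_sum hf hf0 ha, nablaTorsionTwo_eq_sum hf hf0 hb, h_eq,
    Fin.sum_univ_three, nablaTorsionTwo_self_right] at div_zero div_one div_two ⊢
  simp only [he] at swap div_zero div_one div_two ⊢
  simp only [swap _ 1 0, swap _ 2 0, swap _ 2 1] at div_zero div_one div_two ⊢
  set A := G.g.val x a
  set B := G.g.val x b
  -- The curl of the Hodge dual of `S_{αβ}` is the divergence of `S_{αβ}`.
  linear_combination (A (e 1) * B (e 2) - A (e 2) * B (e 1)) * div_zero
    + (A (e 2) * B (e 0) - A (e 0) * B (e 2)) * div_one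
    + (A (e 0) * B (e 1) - A (e 1) * B (e 0)) * div_two

lemma chartDeriv_val_torsionVector_comm {a b : TangentSpace (𝓡 4) x}
    (ha : G.g.val x (u x) a = 0) (hb : G.g.val x (u x) b = 0) :
    chartDeriv a (fun y ↦ G.g.val y (G.torsionVector u y) (coordField b y))
      = chartDeriv b (fun y ↦ G.g.val y (G.torsionVector u y) (coordField a y)) := by
  have comm := hu.nablaTorsionVector_comm ha hb
  have cov_sub := G.cov_coordField_sub a b (mem_chart_source _ x)
  rw [hu.torsion_eq] at cov_sub
  have val_cov_sub := congrArg (G.g.val x (G.torsionVector u x)) cov_sub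
  rw [map_sub, map_smul, val_torsionVector_self, smul_zero] at val_cov_sub
  rw [nablaTorsionVector, nablaTorsionVector] at comm
  linarith

end IsSpinCongruence

end RiemannCartan

end TorsionVector

section LocalToGlobal

variable {X A : Type*} [TopologicalSpace X] [AddCommGroup A]

/-- The bundle over `X` whose fibre at `x` is `A`, in which the local sections on `U i` that are
constant in the `i`-th trivialization stand for the functions differing from `F i` by a constant.
A global continuous section is a function which is locally of the form `F i + const`. -/
def germBundle [TopologicalSpace A] [DiscreteTopology A] (U : X → Set X)
    (hU : ∀ i, IsOpen (U i)) (hmem : ∀ i, i ∈ U i) (F : X → X → A)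
    (hF : ∀ i j, ∀ y ∈ U i ∩ U j, ∀ᶠ z in nhds y, F i z - F j z = F i y - F j y) :
    FiberBundleCore X X A where
  baseSet := U
  isOpen_baseSet := hU
  indexAt := id
  mem_baseSet_at := hmem
  coordChange i j x a := a + (F i x - F j x)
  coordChange_self i x _ a := by rw [sub_self, add_zero]
  continuousOn_coordChange i j := by
    rintro ⟨y, a⟩ ⟨hy, -⟩
    refine ((continuousAt_const (y := a + (F i y - F j y))).congr ?_).continuousWithinAt
    rw [nhds_prod_eq, nhds_discrete A]
    filter_upwards [(hF i j y hy).prod_inl (pure a),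
      (Filter.eventually_pure.2 rfl : ∀ᶠ b in pure a, b = a).prod_inr (nhds y)] with p hp hpa
    rw [hp, hpa]
  coordChange_comp i j k x _ a := by abel

theorem exists_eventuallyEq_add_const [SimplyConnectedSpace X] [LocallyPathConnectedSpace X]
    (U : X → Set X) (hU : ∀ i, IsOpen (U i)) (hmem : ∀ i, i ∈ U i) (F : X → X → A)
    (hF : ∀ i j, ∀ y ∈ U i ∩ U j, ∀ᶠ z in nhds y, F i z - F j z = F i y - F j y) :
    ∃ f : X → A, ∀ i, ∃ c : A, ∀ᶠ z in nhds i, f z = F i z + c := by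
  let _ : TopologicalSpace A := ⊥
  have : DiscreteTopology A := ⟨rfl⟩
  let Z := germBundle U hU hmem F hF
  have covering : IsCoveringMap (Bundle.TotalSpace.proj : Z.TotalSpace → X) :=
    FiberBundle.isCoveringMap (F := A) (E := Z.Fiber)
  have x₀ : X := Classical.arbitrary X
  obtain ⟨s, ⟨-, hs⟩, -⟩ := covering.existsUnique_continuousMap_lifts (ContinuousMap.id X) x₀
    (⟨x₀, (0 : A)⟩ : Z.TotalSpace) rfl
  replace hs (z : X) : (s z).1 = z := congrFun hs z
  let sec (z : X) : A := (s z).2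
  have triv_section (i z : X) : (Z.localTriv i (s z)).2 = sec z + (F z z - F i z) :=
    (rfl : _ = sec z + (F (s z).1 (s z).1 - F i (s z).1)).trans (by rw [hs])
  refine ⟨fun z ↦ F z z + sec z, fun i ↦ ⟨(Z.localTriv i (s i)).2, ?_⟩⟩
  have continuousAt_triv : ContinuousAt (fun z ↦ (Z.localTriv i (s z)).2) i := by
    have hsi : s i ∈ (Z.localTriv i).source := by
      rw [Z.mem_localTriv_source, hs]
      exact hmem i
    exact continuousAt_snd.comp
      (((Z.localTriv i).continuousAt hsi).comp (f := s) s.continuous.continuousAt)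
  have triv_const : ∀ᶠ z in nhds i, (Z.localTriv i (s z)).2 = (Z.localTriv i (s i)).2 :=
    Filter.tendsto_pure.1 (nhds_discrete A ▸ continuousAt_triv.tendsto)
  filter_upwards [triv_const] with z hz
  rw [← hz, triv_section]
  abel

end LocalToGlobal

section Primitive

variable {n : ℕ} {V : Type*} [TopologicalSpace V] [ChartedSpace (EuclideanSpace ℝ (Fin n)) V]

lemma hasMFDerivAt_eq_zero_of_isLocalMax {f : V → ℝ} {y : V} {f' : TangentSpace (𝓡 n) y →L[ℝ] ℝ}
    (hf : HasMFDerivAt (𝓡 n) 𝓘(ℝ) f y f') (hmax : IsLocalMax f y) : f' = 0 := by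
  have hasFDerivWithinAt_chart := hf.2
  rw [ModelWithCorners.range_eq_univ] at hasFDerivWithinAt_chart
  refine IsLocalMax.hasFDerivAt_eq_zero ?_ (hasFDerivWithinAt_univ.1 hasFDerivWithinAt_chart)
  have symm_tendsto := continuousAt_extChartAt_symm (I := 𝓡 n) y
  rw [ContinuousAt, extChartAt_to_inv] at symm_tendsto
  refine (symm_tendsto.eventually hmax).mono fun z hz ↦ ?_
  change f ((extChartAt (𝓡 n) y).symm z) ≤ f ((extChartAt (𝓡 n) y).symm (extChartAt (𝓡 n) y y))
  rwa [extChartAt_to_inv]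

variable [IsManifold (𝓡 n) ∞ V]

lemma eventually_eq_of_hasMFDerivAt_zero {F : Type*} [NormedAddCommGroup F] [NormedSpace ℝ F]
    {f : V → F} {y : V} (hf : ∀ᶠ z in nhds y, HasMFDerivAt (𝓡 n) 𝓘(ℝ, F) f z 0) :
    ∀ᶠ z in nhds y, f z = f y := by
  set ψ := extChartAt (𝓡 n) y
  have hsymm : ψ.symm (ψ y) = y := extChartAt_to_inv y
  have symm_tendsto : ContinuousAt ψ.symm (ψ y) := continuousAt_extChartAt_symm y
  rw [ContinuousAt, hsymm] at symm_tendsto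
  obtain ⟨ε, hε, hball⟩ := Metric.eventually_nhds_iff_ball.1
    ((symm_tendsto.eventually hf).and (extChartAt_target_mem_nhds (I := 𝓡 n) y))
  have deriv_zero (ζ) (hζ : ζ ∈ Metric.ball (ψ y) ε) :
      HasFDerivAt (𝕜 := ℝ) (f ∘ ψ.symm) 0 ζ := by
    have h := (hball ζ hζ).1.comp ζ
      (mdifferentiableAt_extChartAt_symm' (hball ζ hζ).2).hasMFDerivAt
    rw [ContinuousLinearMap.zero_comp] at h
    exact h.hasFDerivAt
  filter_upwards [continuousAt_extChartAt (I := 𝓡 n) y (Metric.ball_mem_nhds _ hε),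
    extChartAt_source_mem_nhds (I := 𝓡 n) y] with z hz hzs
  have := Metric.isOpen_ball.is_const_of_fderiv_eq_zero (𝕜 := ℝ)
    (convex_ball (ψ y) ε).isPreconnected
    (fun ζ hζ ↦ (deriv_zero ζ hζ).differentiableAt.differentiableWithinAt)
    (fun ζ hζ ↦ (deriv_zero ζ hζ).fderiv) hz (Metric.mem_ball_self hε)
  rwa [Function.comp_apply, Function.comp_apply, ψ.left_inv hzs, hsymm] at this

theorem exists_hasMFDerivAt_of_locally [SimplyConnectedSpace V] {F : Type*}
    [NormedAddCommGroup F] [NormedSpace ℝ F] {η : ∀ y : V, TangentSpace (𝓡 n) y →L[ℝ] F}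
    (hη : ∀ y, ∃ f : V → F, ∀ᶠ z in nhds y, HasMFDerivAt (𝓡 n) 𝓘(ℝ, F) f z (η z)) :
    ∃ f : V → F, ∀ y, HasMFDerivAt (𝓡 n) 𝓘(ℝ, F) f y (η y) := by
  have : LocallyPathConnectedSpace V :=
    ChartedSpace.locallyPathConnectedSpace (EuclideanSpace ℝ (Fin n)) V
  choose F' hF' using hη
  choose U hU hUo hUm using fun y ↦ eventually_nhds_iff.1 (hF' y)
  obtain ⟨f, hf⟩ := exists_eventuallyEq_add_const U hUo hUm F' (by
    rintro i j y ⟨hi, hj⟩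
    refine eventually_eq_of_hasMFDerivAt_zero (n := n) (f := fun z ↦ F' i z - F' j z) ?_
    filter_upwards [(hUo i).mem_nhds hi, (hUo j).mem_nhds hj] with z hzi hzj
    have := (hU i z hzi).sub (hU j z hzj)
    rwa [sub_self] at this)
  refine ⟨f, fun y ↦ ?_⟩
  obtain ⟨c, hc⟩ := hf y
  have := (hU y y (hUm y)).add (hasMFDerivAt_const (I := 𝓡 n) (I' := 𝓘(ℝ, F)) c y)
  exact (add_zero (η y)) ▸ this.congr_of_eventuallyEq hc

theorem exists_eq_zero_of_locally_exact [CompactSpace V] [SimplyConnectedSpace V]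
    {η : ∀ y : V, TangentSpace (𝓡 n) y →L[ℝ] ℝ}
    (hη : ∀ y, ∃ f : V → ℝ, ∀ᶠ z in nhds y, HasMFDerivAt (𝓡 n) 𝓘(ℝ) f z (η z)) :
    ∃ y, η y = 0 := by
  obtain ⟨f, hf⟩ := exists_hasMFDerivAt_of_locally hη
  have hcont : Continuous f := continuous_iff_continuousAt.2 fun y ↦ (hf y).continuousAt
  obtain ⟨y, -, hy⟩ := isCompact_univ.exists_isMaxOn Set.univ_nonempty hcont.continuousOn
  exact ⟨y, hasMFDerivAt_eq_zero_of_isLocalMax (hf y) (hy.isLocalMax Filter.univ_mem)⟩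

end Primitive

section ClosedForms

variable {E E' : Type*} [NormedAddCommGroup E] [NormedSpace ℝ E] [NormedAddCommGroup E']
  [NormedSpace ℝ E']

/-- The 1-form `A` on a normed space is closed at `z`. Differentiability is part of the notion,
since `fderiv ℝ A z` has the junk value `0` otherwise. -/
def IsClosedFormAt (A : E → E →L[ℝ] ℝ) (z : E) : Prop :=
  DifferentiableAt ℝ A z ∧ ∀ v w, fderiv ℝ A z v w = fderiv ℝ A z w v

lemma IsClosedFormAt.congr_of_eventuallyEq {A B : E → E →L[ℝ] ℝ} {z : E} (hA : IsClosedFormAt A z)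
    (h : B =ᶠ[nhds z] A) : IsClosedFormAt B z :=
  ⟨hA.1.congr_of_eventuallyEq h, by rw [h.fderiv_eq]; exact hA.2⟩

lemma isClosedFormAt_comp_fderiv {A : E' → E' →L[ℝ] ℝ} {G : E → E'} {z : E}
    (hA : DifferentiableAt ℝ A (G z)) (hG : ContDiffAt ℝ 2 G z)
    (hsymm : ∀ v w, fderiv ℝ A (G z) (fderiv ℝ G z v) (fderiv ℝ G z w)
      = fderiv ℝ A (G z) (fderiv ℝ G z w) (fderiv ℝ G z v)) :
    IsClosedFormAt (fun ζ ↦ (A (G ζ)).comp (fderiv ℝ G ζ)) z := by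
  have hG' : DifferentiableAt ℝ (fderiv ℝ G) z :=
    (hG.fderiv_right (m := 1) one_add_one_eq_two.le).differentiableAt one_ne_zero
  have snd_symm : IsSymmSndFDerivAt ℝ G z :=
    hG.isSymmSndFDerivAt minSmoothness_of_isRCLikeNormedField.le
  have deriv := (hA.hasFDerivAt.comp z (hG.differentiableAt two_ne_zero).hasFDerivAt).clm_comp
    hG'.hasFDerivAt
  refine ⟨deriv.differentiableAt, fun v w ↦ ?_⟩
  rw [show fderiv ℝ (fun ζ ↦ (A (G ζ)).comp (fderiv ℝ G ζ)) z = _ from deriv.fderiv]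
  simp [snd_symm v w, hsymm v w]

lemma differentiableAt_of_clm_apply {F : Type*} [NormedAddCommGroup F] [NormedSpace ℝ F]
    [FiniteDimensional ℝ E'] {A : E → E' →L[ℝ] F} {z : E}
    (hA : ∀ v, DifferentiableAt ℝ (fun ζ ↦ A ζ v) z) : DifferentiableAt ℝ A z := by
  let e : E' ≃L[ℝ] (Fin (Module.finrank ℝ E') → ℝ) :=
    ContinuousLinearEquiv.ofFinrankEq (Module.finrank_fin_fun ℝ).symm
  let coords := (e.arrowCongr (1 : F ≃L[ℝ] F)).trans (ContinuousLinearEquiv.piRing _)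
  exact coords.comp_differentiableAt_iff.1 (differentiableAt_pi.2 fun _ ↦ hA _)

end ClosedForms

section Pullback

variable {m : ℕ} {M : Type*} [TopologicalSpace M] [ChartedSpace (EuclideanSpace ℝ (Fin m)) M]
  {E H N E' H' N' : Type*}
  [NormedAddCommGroup E] [NormedSpace ℝ E] [TopologicalSpace H] {I : ModelWithCorners ℝ E H}
  [TopologicalSpace N] [ChartedSpace H N]
  [NormedAddCommGroup E'] [NormedSpace ℝ E'] [TopologicalSpace H'] {I' : ModelWithCorners ℝ E' H'}
  [TopologicalSpace N'] [ChartedSpace H' N']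

variable (I) in
/-- The pullback of the 1-form `α` by the map `F`. -/
def pullbackForm (α : ∀ x : M, TangentSpace (𝓡 m) x →L[ℝ] ℝ) (F : N → M) (y : N) :
    TangentSpace I y →L[ℝ] ℝ :=
  (α (F y)).comp (mfderiv I (𝓡 m) F y)

variable {α : ∀ x : M, TangentSpace (𝓡 m) x →L[ℝ] ℝ}

lemma pullbackForm_congr {F F' : N → M} {y : N} (h : F =ᶠ[nhds y] F') :
    pullbackForm I α F y = pullbackForm I α F' y := by
  let β (x : M) : EuclideanSpace ℝ (Fin m) →L[ℝ] ℝ := α x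
  have form_eq : β (F y) = β (F' y) := congrArg β h.self_of_nhds
  ext v
  exact (congrArg (β (F y)) (DFunLike.congr_fun h.mfderiv_eq v)).trans
    (DFunLike.congr_fun form_eq _)

lemma pullbackForm_comp {K : N' → M} {G : N → N'} {y : N}
    (hK : MDifferentiableAt I' (𝓡 m) K (G y)) (hG : MDifferentiableAt I I' G y) :
    pullbackForm I α (K ∘ G) y = (pullbackForm I' α K (G y)).comp (mfderiv I I' G y) := by
  rw [pullbackForm, mfderiv_comp y hK hG]
  rfl

variable [IsManifold (𝓡 m) ∞ M] {x : M}

/-- The coordinate expression of the 1-form `α` in the preferred chart at `x`. -/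
def chartForm (α : ∀ x : M, TangentSpace (𝓡 m) x →L[ℝ] ℝ) (x : M) (z : EuclideanSpace ℝ (Fin m)) :
    EuclideanSpace ℝ (Fin m) →L[ℝ] ℝ :=
  pullbackForm 𝓘(ℝ, EuclideanSpace ℝ (Fin m)) α (extChartAt (𝓡 m) x).symm z

lemma chartForm_apply_eventuallyEq (b : TangentSpace (𝓡 m) x) :
    (fun z ↦ chartForm α x z b) =ᶠ[nhds (extChartAt (𝓡 m) x x)]
      (fun y ↦ α y (coordField b y)) ∘ (extChartAt (𝓡 m) x).symm := by
  filter_upwards [extChartAt_target_mem_nhds (I := 𝓡 m) x] with z hz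
  rw [Function.comp_apply,
    coordField_eq_mfderiv b (by simpa using (extChartAt (𝓡 m) x).map_target hz),
    (extChartAt (𝓡 m) x).right_inv hz]
  rfl

lemma differentiableAt_chartForm
    (hα : ∀ c : TangentSpace (𝓡 m) x,
      MDifferentiableAt (𝓡 m) 𝓘(ℝ) (fun y ↦ α y (coordField c y)) x) :
    DifferentiableAt ℝ (chartForm α x) (extChartAt (𝓡 m) x x) :=
  differentiableAt_of_clm_apply fun b ↦
    (differentiableAt_comp_chart_symm (hα b)).congr_of_eventuallyEq
      (chartForm_apply_eventuallyEq b)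

lemma fderiv_chartForm
    (hα : ∀ c : TangentSpace (𝓡 m) x,
      MDifferentiableAt (𝓡 m) 𝓘(ℝ) (fun y ↦ α y (coordField c y)) x)
    (a b : TangentSpace (𝓡 m) x) :
    fderiv ℝ (chartForm α x) (extChartAt (𝓡 m) x x) a b
      = chartDeriv a (fun y ↦ α y (coordField b y)) := by
  have deriv_apply (w : EuclideanSpace ℝ (Fin m)) :=
    ((ContinuousLinearMap.apply ℝ ℝ w).hasFDerivAt.comp _
      (differentiableAt_chartForm hα).hasFDerivAt).fderiv
  exact DFunLike.congr_fun
    ((deriv_apply b).symm.trans (chartForm_apply_eventuallyEq b).fderiv_eq) a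

lemma pullbackForm_eq_chartForm_comp {F : E → M} {ζ : E}
    (hF : MDifferentiableAt 𝓘(ℝ, E) (𝓡 m) F ζ) (hx : F ζ ∈ (extChartAt (𝓡 m) x).source) :
    pullbackForm 𝓘(ℝ, E) α F ζ = (chartForm α x (extChartAt (𝓡 m) x (F ζ))).comp
      (fderiv ℝ (extChartAt (𝓡 m) x ∘ F) ζ) := by
  have hφ := mdifferentiableAt_extChartAt_symm' ((extChartAt (𝓡 m) x).map_source hx)
  have hG : MDifferentiableAt 𝓘(ℝ, E) 𝓘(ℝ, EuclideanSpace ℝ (Fin m)) (extChartAt (𝓡 m) x ∘ F) ζ :=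
    (mdifferentiableAt_extChartAt (by simpa using hx)).comp ζ hF
  have factor : F =ᶠ[nhds ζ] (extChartAt (𝓡 m) x).symm ∘ (extChartAt (𝓡 m) x ∘ F) :=
    Filter.mem_of_superset (hF.continuousAt (extChartAt_source_mem_nhds' hx))
      fun z hz ↦ ((extChartAt (𝓡 m) x).left_inv hz).symm
  rw [pullbackForm_congr factor, pullbackForm_comp (G := extChartAt (𝓡 m) x ∘ F) hφ hG,
    mfderiv_eq_fderiv]
  rfl

lemma fderiv_extChartAt_comp {F : E → M} {ζ : E} (hF : MDifferentiableAt 𝓘(ℝ, E) (𝓡 m) F ζ)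
    (v : E) : fderiv ℝ (extChartAt (𝓡 m) (F ζ) ∘ F) ζ v = mfderiv 𝓘(ℝ, E) (𝓡 m) F ζ v := by
  have chain := mfderiv_comp ζ
    (mdifferentiableAt_extChartAt (I := 𝓡 m) (mem_chart_source _ (F ζ))) hF
  rw [mfderiv_extChartAt_self, mfderiv_eq_fderiv] at chain
  exact DFunLike.congr_fun chain v

theorem isClosedFormAt_pullbackForm {F : E → M} {ζ₀ : E}
    (hF : ContMDiffAt 𝓘(ℝ, E) (𝓡 m) ∞ F ζ₀)
    (hα : ∀ c : TangentSpace (𝓡 m) (F ζ₀),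
      MDifferentiableAt (𝓡 m) 𝓘(ℝ) (fun y ↦ α y (coordField c y)) (F ζ₀))
    (hclosed : ∀ a ∈ Set.range (mfderiv 𝓘(ℝ, E) (𝓡 m) F ζ₀),
      ∀ b ∈ Set.range (mfderiv 𝓘(ℝ, E) (𝓡 m) F ζ₀),
      chartDeriv a (fun y ↦ α y (coordField b y)) = chartDeriv b (fun y ↦ α y (coordField a y))) :
    IsClosedFormAt (pullbackForm 𝓘(ℝ, E) α F) ζ₀ := by
  have hG : ContDiffAt ℝ 2 (extChartAt (𝓡 m) (F ζ₀) ∘ F) ζ₀ :=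
    ((contMDiffAt_extChartAt.comp ζ₀ hF).contDiffAt).of_le ENat.LEInfty.out
  have : IsManifold (𝓡 m) 1 M := .of_le (n := ∞) ENat.LEInfty.out
  have fderiv_eq := fderiv_extChartAt_comp (hF.mdifferentiableAt (by simp))
  have fderiv_symm (v w : E) :
      fderiv ℝ (chartForm α (F ζ₀)) (extChartAt (𝓡 m) (F ζ₀) (F ζ₀))
          (fderiv ℝ (extChartAt (𝓡 m) (F ζ₀) ∘ F) ζ₀ v)
          (fderiv ℝ (extChartAt (𝓡 m) (F ζ₀) ∘ F) ζ₀ w)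
        = fderiv ℝ (chartForm α (F ζ₀)) (extChartAt (𝓡 m) (F ζ₀) (F ζ₀))
          (fderiv ℝ (extChartAt (𝓡 m) (F ζ₀) ∘ F) ζ₀ w)
          (fderiv ℝ (extChartAt (𝓡 m) (F ζ₀) ∘ F) ζ₀ v) := by
    rw [fderiv_eq v, fderiv_eq w]
    exact (fderiv_chartForm hα _ _).trans
      ((hclosed _ ⟨v, rfl⟩ _ ⟨w, rfl⟩).trans (fderiv_chartForm hα _ _).symm)
  refine (isClosedFormAt_comp_fderiv (G := extChartAt (𝓡 m) (F ζ₀) ∘ F)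
    (differentiableAt_chartForm hα) hG fderiv_symm).congr_of_eventuallyEq ?_
  filter_upwards [
    (contMDiffAt_iff_contMDiffAt_nhds (n := 1) (by simp)).1 (hF.of_le ENat.LEInfty.out),
    hF.continuousAt (extChartAt_source_mem_nhds (I := 𝓡 m) (F ζ₀))] with ζ hFζ hζ
  exact pullbackForm_eq_chartForm_comp (hFζ.mdifferentiableAt one_ne_zero) hζ

variable {n : ℕ} {V : Type*} [TopologicalSpace V] [ChartedSpace (EuclideanSpace ℝ (Fin n)) V]
  [IsManifold (𝓡 n) ∞ V] {ι : V → M} (hι : ContMDiff (𝓡 n) (𝓡 m) ∞ ι)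
  (hα : ∀ (y : V) (c : TangentSpace (𝓡 m) (ι y)),
    MDifferentiableAt (𝓡 m) 𝓘(ℝ) (fun x ↦ α x (coordField c x)) (ι y))
  (hclosed : ∀ y : V, ∀ a ∈ Set.range (mfderiv (𝓡 n) (𝓡 m) ι y),
    ∀ b ∈ Set.range (mfderiv (𝓡 n) (𝓡 m) ι y),
    chartDeriv a (fun x ↦ α x (coordField b x)) = chartDeriv b (fun x ↦ α x (coordField a x)))
include hι hα hclosed

lemma isClosedFormAt_pullbackForm_comp_extChartAt_symm
    {y : V} {ζ : EuclideanSpace ℝ (Fin n)} (hζ : ζ ∈ (extChartAt (𝓡 n) y).target) :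
    IsClosedFormAt (pullbackForm 𝓘(ℝ, EuclideanSpace ℝ (Fin n)) α
      (ι ∘ (extChartAt (𝓡 n) y).symm)) ζ := by
  have symm_smooth : ContMDiffAt 𝓘(ℝ, EuclideanSpace ℝ (Fin n)) (𝓡 n) ∞
      (extChartAt (𝓡 n) y).symm ζ :=
    (contMDiffOn_extChartAt_symm y).contMDiffAt (extChartAt_target_mem_nhds' hζ)
  have range_subset : Set.range (mfderiv 𝓘(ℝ, EuclideanSpace ℝ (Fin n)) (𝓡 m)
        (ι ∘ (extChartAt (𝓡 n) y).symm) ζ)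
      ⊆ Set.range (mfderiv (𝓡 n) (𝓡 m) ι ((extChartAt (𝓡 n) y).symm ζ)) := by
    rw [mfderiv_comp ζ (hι.mdifferentiable (by simp) _)
      (symm_smooth.mdifferentiableAt (by simp))]
    rintro _ ⟨v, rfl⟩
    exact ⟨_, rfl⟩
  exact isClosedFormAt_pullbackForm ((hι _).comp ζ symm_smooth) (hα _)
    fun a ha b hb ↦ hclosed _ a (range_subset ha) b (range_subset hb)

lemma exists_hasMFDerivAt_pullbackForm (y : V) : ∃ f : V → ℝ, ∀ᶠ z in nhds y,
      HasMFDerivAt (𝓡 n) 𝓘(ℝ) f z (pullbackForm (𝓡 n) α ι z) := by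
  set ψ := extChartAt (𝓡 n) y
  obtain ⟨ε, hε, hball⟩ := Metric.mem_nhds_iff.1 (extChartAt_target_mem_nhds (I := 𝓡 n) y)
  have closed (ζ) (hζ : ζ ∈ Metric.ball (ψ y) ε) :=
    isClosedFormAt_pullbackForm_comp_extChartAt_symm hι hα hclosed (hball hζ)
  obtain ⟨f, hf⟩ := (convex_ball (ψ y) ε).exists_forall_hasFDerivAt_of_fderiv_symmetric
    Metric.isOpen_ball (fun ζ hζ ↦ (closed ζ hζ).1.differentiableWithinAt)
    (fun ζ hζ ↦ (closed ζ hζ).2)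
  refine ⟨f ∘ ψ, ?_⟩
  filter_upwards [continuousAt_extChartAt (I := 𝓡 n) y (Metric.ball_mem_nhds _ hε),
    eventually_mem_nhds_iff.2 (extChartAt_source_mem_nhds (I := 𝓡 n) y)] with z hz hzs
  have hψz : MDifferentiableAt (𝓡 n) 𝓘(ℝ, EuclideanSpace ℝ (Fin n)) ψ z :=
    mdifferentiableAt_extChartAt (by
      rw [← extChartAt_source (𝓡 n)]
      exact mem_of_mem_nhds hzs)
  have factor : ι =ᶠ[nhds z] (ι ∘ ψ.symm) ∘ ψ :=
    Filter.mem_of_superset hzs fun p hp ↦ congrArg ι (ψ.left_inv hp).symm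
  rw [pullbackForm_congr factor, pullbackForm_comp (G := ψ)
    ((hι.mdifferentiable (by simp) _).comp _ (mdifferentiableAt_extChartAt_symm' (hball hz))) hψz]
  exact (hf (ψ z) hz).hasMFDerivAt.comp z hψz.hasMFDerivAt

theorem exists_pullbackForm_eq_zero [CompactSpace V] [SimplyConnectedSpace V] :
    ∃ y, pullbackForm (𝓡 n) α ι y = 0 :=
  exists_eq_zero_of_locally_exact (exists_hasMFDerivAt_pullbackForm hι hα hclosed)

end Pullback

section WeyssenhoffFluid

variable {M : Type*} [TopologicalSpace M]
  [ChartedSpace (EuclideanSpace ℝ (Fin 4)) M] [IsManifold (𝓡 4) ∞ M] (x : M)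

namespace RiemannCartan

variable (G : RiemannCartan M)

/-- The trace `S_{αμ}{}^μ` as a linear form in the index `α`. -/
def torsionTraceₗ : TangentSpace (𝓡 4) x →ₗ[ℝ] ℝ where
  toFun := G.torsionTrace x
  map_add' a b := by
    simp only [torsionTrace, torsionTensor, map_add, add_apply, smul_add, mul_add,
      Finset.sum_add_distrib]
  map_smul' c a := by
    simp only [torsionTrace, torsionTensor, map_smul, smul_apply, Finset.mul_sum, smul_eq_mul,
      RingHom.id_apply]
    exact Finset.sum_congr rfl fun i _ ↦ by ring

end RiemannCartan

namespace SpinningCosmology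

variable (C : SpinningCosmology M)

lemma spin_u_left (a : TangentSpace (𝓡 4) x) : C.spin x (C.u x) a = 0 := by
  rw [C.spin_antisymm, C.spin_u, neg_zero]

lemma val_torsionTensor (a b c : TangentSpace (𝓡 4) x) :
    C.g.val x (C.torsionTensor x a b) c
      = C.spin x a b * C.g.val x (C.u x) c
        - (C.g.val x c a * C.torsionTrace x b - C.g.val x c b * C.torsionTrace x a) := by
  rw [eq_sub_iff_add_eq, C.cartan]
  field_simp [Real.pi_ne_zero]

lemma torsionTrace_eq_zero (a : TangentSpace (𝓡 4) x) : C.torsionTrace x a = 0 := by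
  have he := C.frame_isOrthonormal x
  have spin_trace :
      ∑ i, eta i * C.g.val x (C.u x) (C.frame x i) * C.spin x a (C.frame x i) = 0 :=
    (he.sum_apply (C.spin x a).toLinearMap (C.u x)).trans (C.spin_u x a)
  have metric_trace :
      ∑ i, eta i * C.g.val x a (C.frame x i) * C.torsionTrace x (C.frame x i)
        = C.torsionTrace x a :=
    he.sum_apply (C.torsionTraceₗ x) a
  have dimension : ∑ i, eta i * C.g.val x (C.frame x i) (C.frame x i) = 4 := by
    simp [he _ _, eta_mul_self]
  have trace : C.torsionTrace x a
      = ∑ i, eta i * C.g.val x (C.u x) (C.frame x i) * C.spin x a (C.frame x i)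
        - ∑ i, eta i * C.g.val x a (C.frame x i) * C.torsionTrace x (C.frame x i)
        + (∑ i, eta i * C.g.val x (C.frame x i) (C.frame x i)) * C.torsionTrace x a := by
    rw [Finset.sum_mul, ← Finset.sum_sub_distrib, ← Finset.sum_add_distrib]
    refine Finset.sum_congr rfl fun i _ ↦ ?_
    rw [C.val_torsionTensor, C.g.symm x a]
    ring
  rw [spin_trace, metric_trace, dimension] at trace
  linarith

lemma torsionTensor_eq (a b : TangentSpace (𝓡 4) x) :
    C.torsionTensor x a b = C.spin x a b • C.u x :=
  LorentzMetric.eq_of_val_eq (g := C.g) fun c ↦ by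
    simp [C.val_torsionTensor, C.torsionTrace_eq_zero]

lemma torsionTwo_eq_spin (a b : TangentSpace (𝓡 4) x) :
    C.torsionTwo C.u x a b = C.spin x a b := by
  rw [RiemannCartan.torsionTwo, C.torsionTensor_eq]
  simp [RiemannCartan.proj_apply, C.spin_u, C.spin_u_left, C.u_unit]

theorem isSpinCongruence : C.IsSpinCongruence C.u where
  smooth := C.u_smooth
  unit := C.u_unit
  torsion_eq x a b := by
    rw [C.torsionTwo_eq_spin, mul_smul, ← C.torsionTensor_eq, RiemannCartan.torsionTensor,
      smul_smul]
    norm_num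
  acceleration_free := C.acceleration_free
  shear_free := C.shear_free
  expansion_homogeneous := C.expansion_homogeneous
  vorticity_eq := C.vorticity_eq
  ricci_eq_zero x b hb := by
    have := C.einstein x (C.u x) b
    simp only [RiemannCartan.h, hb, C.q_orthogonal] at this
    linarith

end SpinningCosmology

end WeyssenhoffFluid

end

end EinsteinCartan

open EinsteinCartan in
theorem theorem2_general {M : Type*} [TopologicalSpace M] [T2Space M]
    [ChartedSpace (EuclideanSpace ℝ (Fin 4)) M] [IsManifold (𝓡 4) ∞ M]
    {G : RiemannCartan M} {u : ∀ x : M, TangentSpace (𝓡 4) x} (hu : G.IsSpinCongruence u)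
    {n : ℕ} {V : Type*} [TopologicalSpace V] [ChartedSpace (EuclideanSpace ℝ (Fin n)) V]
    [IsManifold (𝓡 n) ∞ V] [CompactSpace V] [SimplyConnectedSpace V]
    {ι : V → M} (hι : ContMDiff (𝓡 n) (𝓡 4) ∞ ι)
    (hrange : ∀ (y : V) (a : TangentSpace (𝓡 4) (ι y)),
      a ∈ Set.range (mfderiv (𝓡 n) (𝓡 4) ι y) ↔ G.g.val (ι y) a (u (ι y)) = 0) :
    ∃ y, G.torsionVector u (ι y) = 0 := by
  simp only [G.g.symm _ _ (u _)] at hrange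
  obtain ⟨y, hy⟩ := exists_pullbackForm_eq_zero
    (α := fun x ↦ G.g.val x (G.torsionVector u x)) hι
    (fun y c ↦ (hu.contMDiffAt_val_torsionVector c).mdifferentiableAt (by simp))
    fun y a ha b hb ↦ hu.chartDeriv_val_torsionVector_comm ((hrange y a).1 ha) ((hrange y b).1 hb)
  refine ⟨y, LorentzMetric.eq_of_val_eq (g := G.g) fun c ↦ ?_⟩
  obtain ⟨v, hv⟩ := (hrange y (G.proj u (ι y) c)).2 (by simp [G.proj_apply, hu.unit])
  have val_proj : G.g.val (ι y) (G.torsionVector u (ι y)) (G.proj u (ι y) c) = 0 :=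
    hv ▸ DFunLike.congr_fun hy v
  simpa [G.proj_apply, G.val_torsionVector_self] using val_proj

theorem theorem2 {M : Type*} [TopologicalSpace M] [T2Space M]
    [ChartedSpace (EuclideanSpace ℝ (Fin 4)) M] [IsManifold (𝓡 4) ∞ M]
    (C : EinsteinCartan.SpinningCosmology M)
    {V : Type*} [TopologicalSpace V] [ChartedSpace (EuclideanSpace ℝ (Fin 3)) V]
    [IsManifold (𝓡 3) ∞ V] [SimplyConnectedSpace V]
    (ι : V → M) (hι : EinsteinCartan.IsOrthogonalSlice C ι)
    (hS : ∀ y : V, C.g.val (ι y) (C.torsionVector C.u (ι y)) (C.torsionVector C.u (ι y)) ≠ 0) :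
    ¬ CompactSpace V := by
  intro
  obtain ⟨y, hy⟩ := theorem2_general C.isSpinCongruence hι.smooth hι.tangent
  exact hS y (by rw [hy, map_zero])
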